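/- **Setting.** Let $A$ be a finite, totally ordered alphabet. A kernel $P$ assigns to every infinite past $\underline a=\ldots a_{-2}a_{-1}$ a probability distribution $P(\cdot\mid\underline a)$ on $A$. Put $\alpha(a)=\inf_{\underline z}P(a\mid\underline z)$ and $\alpha_{-1}=\sum_{a\in A}\alpha(a)$, and assume that $P$ is weakly non-null, i.e. $\alpha_{-1}>0$. A *context tree* $\tau$ is a set of finite or infinite strings (contexts), none a proper suffix of another, such that every past $\underline a$ has exactly one suffix $c_\tau(\underline a)$ in $\tau$. It is a *skeleton* if it is the smallest context tree containing its infinite contexts; the tree $\{\emptyset\}$ is a skeleton. For a finite string $v$ and $k\ge 0$ let $\alpha_k^v=\inf_{w\in A^k}\sum_{a\in A}\inf_{\underline z}P(a\mid v\,w\,\underline z)$, where $v\,w\,\underline z$ is the past whose most recent symbols are $v$, preceded in time by $w$, preceded in time by $\underline z$. The kernel $P$ is *strongly locally continuous*, $P\in SLC(\tau)$, if for every finite context $v\in\tau$ there is a positive integer $h(v)$ with $\alpha_k^v=1$ for all $k\ge h(v)$. Fix such integers and let $h(i)=\sup\{h(v): v\in\tau,\ |v|\le i\}$ and $h^{-1}(i)=\inf\{k\ge1: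 h(k)>i\}$, with $\inf\emptyset=\infty$. Let $(U_i)_{i\in\mathbb Z}$ be i.i.d. uniform on $[0,1[$. Let $Y_i=a$ if $\sum_{b<a}\alpha(b)\le U_i<\sum_{b\le a}\alpha(b)$, and $Y_i=\star$ if $U_i\ge\alpha_{-1}$. Let $c_\tau^n$ be the supremum of $|c_\tau(\underline y)|$ over all pasts $\underline y$ obtained from $(Y_i)_{i\le n}$ by replacing each $\star$ by some letter. Let $\bar\theta[0]$ be the supremum of the times $i\le0$ such that, for every $j\in\{i,\dots,0\}$, $Y_j\in A$ or $c_\tau^{j-1}\le j-i$. (If there is no such $i$, then $|\bar\theta[0]|=\infty$.) An *update function* for $P$ is a map $F$ from (pasts)$\,\times[0,1[$ to $A$ such that $F(\underline a,U_0)$ has law $P(\cdot\mid\underline a)$ for every past $\underline a$. For $j\le k$, $F_{[j,k]}(\underline a)$ is the symbol at time $k$ when the past before time $j$ is $\underline a$ and the symbols at times $j,j+1,\dots,k$ are generated successively by $F$ using $U_j,\dots,U_k$. For $m\le n$, $\theta[m,n]$ is the largest $j\le m$ such that none of $F_{[j,m]}(\underline a),\dots,F_{[j,n]}(\underline a)$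 depends on $\underline a$, and $\theta[0]=\theta[0,0]$. If there is no such $j$, then $\theta[m,n]=-\infty$. Coupling from the past (CFTP) with $F$ is *feasible* if every $\theta[m,n]$, $m\le n$, is almost surely finite. A sequence $(c_n)$ *decays exponentially fast* if $c_n\le Dd^n$ for all $n\ge 0$, for some $D>0$ and $0<d<1$. A random time $W$ has *summable* (*exponential*) tail if $(\mathbb P(|W|\ge n))_{n\ge0}$ is summable (decays exponentially fast). **Statement.** Let $\tau$ be a skeleton, $P\in SLC(\tau)$ weakly non-null, and assume $\mathbb E|\bar\theta[0]|<\infty$. Put $A_0=\alpha_{-1}$ and $$A_m=1-\mathbb E(|\bar\theta[0]|+1)\,\mathbb P\big(c_\tau^0>h^{-1}(m)\big),\qquad m\ge1.$$ Then there is an update function $F$ for $P$ such that: 1. if $\sum_{k\ge1}\prod_{j=0}^{k-1}A_j=+\infty$, then $\theta[0]$ is almost surely finite; 2. if $\sum_{k\ge0}(1-A_k)<+\infty$, then $\theta[0]$ has summable tail; 3. if $\bar\theta[0]$ has exponential tail and $(1-A_k)_{k\ge0}$ decays exponentially fast, then $\theta[0]$ has exponential tail. In each of these three regimes, CFTP with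 update function $F$ is feasible. -/

import Mathlib

open MeasureTheory Filter Topology
open scoped ENNReal

namespace ContextChain

/-! Strings of past symbols are written with the MOST RECENT symbol first: the past
`… a₋₂ a₋₁` is the function `ℕ → A` with `k ↦ a₋₍ₖ₊₁₎`, and a finite string `a₋ₗ … a₋₁` is the
list `[a₋₁, …, a₋ₗ]`.  So a suffix of a past is an initial segment of the function. -/

/-- Finite or infinite strings of past symbols. -/
inductive Str (A : Type*) where
  | fin (v : List A) : Str A
  | inf (x : ℕ → A) : Str A

/-- Length of a string. -/
def Str.length {A : Type*} : Str A → ℕ∞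
  | .fin v => (v.length : ℕ∞)
  | .inf _ => ⊤

/-- `v.IsSuffix w`: `w = u v` for some, possibly empty, string `u` of older symbols. -/
def Str.IsSuffix {A : Type*} : Str A → Str A → Prop
  | .fin v, .fin w => v <+: w
  | .fin v, .inf x => ∀ (i : ℕ) (hi : i < v.length), v[i] = x i
  | .inf x, .inf y => x = y
  | .inf _, .fin _ => False

/-- The past whose most recent symbols are those of `v`, preceded in time by `z`. -/
def append {A : Type*} (v : List A) (z : ℕ → A) : ℕ → A :=
  fun i => if h : i < v.length then v[i] else z (i - v.length)

/-- Context trees: sets of strings that partition the set of infinite pasts and no element of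
which is a proper suffix of another one. -/
structure ContextTree (A : Type*) where
  carrier : Set (Str A)
  partition : ∀ x : ℕ → A, ∃! v : Str A, v ∈ carrier ∧ v.IsSuffix (.inf x)
  suffix_free : ∀ v ∈ carrier, ∀ w ∈ carrier, v.IsSuffix w → v = w

/-- The context of the past `x`. -/
noncomputable def ContextTree.context {A : Type*} (τ : ContextTree A) (x : ℕ → A) : Str A :=
  (τ.partition x).choose

/-- A skeleton is the smallest context tree that contains its own infinite contexts (`τ` is smaller
than `τ'` if it is obtained by pruning `τ'`: every element of `τ'` has a suffix in `τ`).
The tree whose only context is the empty string satisfies this. -/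
def ContextTree.IsSkeleton {A : Type*} (τ : ContextTree A) : Prop :=
  ∀ τ' : ContextTree A, (∀ x : ℕ → A, Str.inf x ∈ τ.carrier → Str.inf x ∈ τ'.carrier) →
    ∀ w ∈ τ'.carrier, ∃ v ∈ τ.carrier, v.IsSuffix w

/-- Transition probability kernels on a finite alphabet; `P a x` is `P(a | x)`. -/
structure TransitionKernel (A : Type*) [Fintype A] where
  toFun : A → (ℕ → A) → ℝ
  nonneg : ∀ a x, 0 ≤ toFun a x
  sum_eq_one : ∀ x, ∑ a, toFun a x = 1

instance {A : Type*} [Fintype A] :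
    CoeFun (TransitionKernel A) (fun _ => A → (ℕ → A) → ℝ) := ⟨TransitionKernel.toFun⟩

/-- `α(a) = inf_z P(a|z)`. -/
noncomputable def alphaLetter {A : Type*} [Fintype A] (P : TransitionKernel A) (a : A) : ℝ :=
  ⨅ z : ℕ → A, P a z

/-- `α₋₁ = ∑_a α(a)`. -/
noncomputable def alphaMinusOne {A : Type*} [Fintype A] (P : TransitionKernel A) : ℝ :=
  ∑ a, alphaLetter P a

/-- Weak non-nullness. -/
def WeaklyNonNull {A : Type*} [Fintype A] (P : TransitionKernel A) : Prop :=
  0 < alphaMinusOne P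

/-- `α_k^v`: the infimum over strings `w` of length `k` of `∑_a inf_z P(a | v w z)`. -/
noncomputable def alphaCtx {A : Type*} [Fintype A] (P : TransitionKernel A)
    (v : List A) (k : ℕ) : ℝ :=
  ⨅ w : Fin k → A, ∑ a, ⨅ z : ℕ → A, P a (append (v ++ List.ofFn w) z)

/-- `P` is strongly locally continuous with respect to `τ`, with the positive integers `h(v)` as
witnesses: `α_k^v = 1` for every finite context `v` and every `k ≥ h(v)`. -/
def IsSLCWith {A : Type*} [Fintype A] (P : TransitionKernel A) (τ : ContextTree A)
    (h : List A → ℕ) : Prop :=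
  ∀ v : List A, Str.fin v ∈ τ.carrier → 0 < h v ∧ ∀ k ≥ h v, alphaCtx P v k = 1

/-- `h(i)`: the supremum of `h(v)` over the contexts `v` of length at most `i`. -/
noncomputable def hSup {A : Type*} (τ : ContextTree A) (h : List A → ℕ) (i : ℕ) : ℕ∞ :=
  ⨆ v ∈ {v : List A | Str.fin v ∈ τ.carrier ∧ v.length ≤ i}, (h v : ℕ∞)

/-- `h⁻¹(i) = inf {k ≥ 1 : h(k) > i}`, which is `∞` if there is no such `k`. -/
noncomputable def hInv {A : Type*} (τ : ContextTree A) (h : List A → ℕ) (i : ℕ) : ℕ∞ :=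
  ⨅ k ∈ {k : ℕ | 1 ≤ k ∧ (i : ℕ∞) < hSup τ h k}, (k : ℕ∞)

/-! ### The driving sequence -/

/-- The interval `[0,1[`. -/
abbrev UnitIco : Type := Set.Ico (0 : ℝ) 1

/-- The uniform distribution (Lebesgue measure) on `[0,1[`. -/
noncomputable def unif : Measure UnitIco :=
  Measure.comap ((↑) : UnitIco → ℝ) volume

instance : IsProbabilityMeasure unif := by
  refine ⟨?_⟩
  rw [unif, comap_subtype_coe_apply measurableSet_Ico, Set.image_univ, Subtype.range_coe,
    Real.volume_Ico]
  norm_num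

/-- The law of a sequence `(U_i)_{i ∈ ℤ}` of i.i.d. uniform variables on `[0,1[`. -/
noncomputable def unifSeq : Measure (ℤ → UnitIco) :=
  Measure.infinitePi (fun _ : ℤ => unif)

/-- The letter or star (`none`) read off from one uniform variable: it is the letter `a` if
`∑_{j<a} α(j) ≤ u < ∑_{j≤a} α(j)`, and the star if there is no such letter, i.e. if
`u ≥ α₋₁`. -/
noncomputable def letterOf {A : Type*} [Fintype A] [LinearOrder A] (P : TransitionKernel A)
    (u : UnitIco) : Option A :=
  open Classical in
  if h : ∃ a : A, ∑ j with j < a, alphaLetter P j ≤ (u : ℝ) ∧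
      (u : ℝ) < ∑ j with j ≤ a, alphaLetter P j
  then some h.choose else none

/-- The past up to and including time `n` of the sequence `Y(b)`, which is `Y` with each star
replaced by the symbol of `b` at the same time. -/
noncomputable def filledPast {A : Type*} [Fintype A] [LinearOrder A] (P : TransitionKernel A)
    (u : ℤ → UnitIco) (b : ℤ → A) (n : ℤ) : ℕ → A :=
  fun k => (letterOf P (u (n - k))).getD (b (n - k))

/-- `c_τ^n`: the maximal length of the context at time `n`, given `Y`. -/
noncomputable def maxCtx {A : Type*} [Fintype A] [LinearOrder A] (P : TransitionKernel A)
    (τ : ContextTree A) (u : ℤ → UnitIco) (n : ℤ) : ℕ∞ :=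
  ⨆ b : ℤ → A, (τ.context (filledPast P u b n)).length

/-- Good coalescence times for time `m`: the times `i ≤ m` such that for each `j` with `i ≤ j ≤ m`
either `Y_j` is a letter or the contexts of the past before `j` have length at most `j - i`, i.e.
they are contained in the window `{i, …, j - 1}`. -/
def goodTimes {A : Type*} [Fintype A] [LinearOrder A] (P : TransitionKernel A)
    (τ : ContextTree A) (u : ℤ → UnitIco) (m : ℤ) : Set ℤ :=
  {i | i ≤ m ∧ ∀ j, i ≤ j → j ≤ m →
    letterOf P (u j) ≠ none ∨ maxCtx P τ u (j - 1) ≤ ((j - i).toNat : ℕ∞)}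

/-- The absolute value of the maximum of a set of times `≤ 0`; it is `∞` if the set is empty. -/
noncomputable def absMax (S : Set ℤ) : ℕ∞ := ⨅ n ∈ {n : ℕ | -(n : ℤ) ∈ S}, (n : ℕ∞)

/-- `|θ̄[0]|`, where `θ̄[0]` is the largest good coalescence time for time `0`. -/
noncomputable def absGood {A : Type*} [Fintype A] [LinearOrder A] (P : TransitionKernel A)
    (τ : ContextTree A) (u : ℤ → UnitIco) : ℕ∞ :=
  absMax (goodTimes P τ u 0)

/-- `E|θ̄[0]|`. -/
noncomputable def meanGood {A : Type*} [Fintype A] [LinearOrder A] (P : TransitionKernel A)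
    (τ : ContextTree A) : ℝ≥0∞ :=
  ∫⁻ u, (absGood P τ u : ℝ≥0∞) ∂unifSeq

/-- The probabilistic skeleton is good. -/
def IsGood {A : Type*} [Fintype A] [LinearOrder A] (P : TransitionKernel A)
    (τ : ContextTree A) : Prop :=
  meanGood P τ < ∞

/-! ### Coupling from the past -/

/-- `F` is an update function for `P`. -/
def IsUpdate {A : Type*} [Fintype A] (P : TransitionKernel A)
    (F : (ℕ → A) → UnitIco → A) : Prop :=
  ∀ x a, MeasurableSet {s | F x s = a} ∧ unif {s | F x s = a} = ENNReal.ofReal (P a x)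

/-- The past before time `j + n`, if the past before time `j` is `x` and the symbols at times
`j, …, j + n - 1` are generated successively by `F`. -/
def runPast {A : Type*} (F : (ℕ → A) → UnitIco → A) (x : ℕ → A) (u : ℤ → UnitIco) (j : ℤ) :
    ℕ → ℕ → A
  | 0 => x
  | n + 1 => append [F (runPast F x u j n) (u (j + n))] (runPast F x u j n)

/-- `F_{[j,k]}(x, U_j^k)`, for `j ≤ k`: the symbol generated at time `k` from the past `x` before
time `j`. -/
def iter {A : Type*} (F : (ℕ → A) → UnitIco → A) (x : ℕ → A) (u : ℤ → UnitIco) (j k : ℤ) : A :=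
  F (runPast F x u j (k - j).toNat) (u k)

/-- The times `j ≤ m` such that none of the symbols generated at times `m, …, n` depends on the
past before `j`.  The coalescence time `θ[m,n]` is the maximum of this set. -/
def coalTimes {A : Type*} (F : (ℕ → A) → UnitIco → A) (u : ℤ → UnitIco) (m n : ℤ) : Set ℤ :=
  {j | j ≤ m ∧ ∀ k, m ≤ k → k ≤ n → ∀ x y : ℕ → A, iter F x u j k = iter F y u j k}

/-- `|θ[0]|`, which is `∞` if there is no coalescence. -/
noncomputable def absCoal {A : Type*} (F : (ℕ → A) → UnitIco → A) (u : ℤ → UnitIco) : ℕ∞ :=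
  absMax (coalTimes F u 0 0)

/-- CFTP with `F` is feasible: every `θ[m,n]` is almost surely finite. -/
def IsFeasible {A : Type*} (F : (ℕ → A) → UnitIco → A) : Prop :=
  ∀ m n : ℤ, m ≤ n → ∀ᵐ u ∂unifSeq, (coalTimes F u m n).Nonempty

/-- `W` (the absolute value of a random time) has summable tail. -/
def SummableTail (W : (ℤ → UnitIco) → ℕ∞) : Prop :=
  ∑' n : ℕ, unifSeq {u | (n : ℕ∞) ≤ W u} < ∞

/-- A sequence of reals decays exponentially fast to zero. -/
def ExpDecay (c : ℕ → ℝ) : Prop :=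
  ∃ D d : ℝ, 0 < D ∧ 0 < d ∧ d < 1 ∧ ∀ n, c n ≤ D * d ^ n

/-- `W` (the absolute value of a random time) has exponential tail. -/
def ExpTail (W : (ℤ → UnitIco) → ℕ∞) : Prop :=
  ExpDecay (fun n => (unifSeq {u | (n : ℕ∞) ≤ W u}).toReal)

/-- `A_0 = α₋₁` and `A_m = 1 - (E|θ̄[0]| + 1) P(c_τ^0 > h⁻¹(m))` for `m ≥ 1`. -/
noncomputable def slcSeq {A : Type*} [Fintype A] [LinearOrder A] (P : TransitionKernel A)
    (τ : ContextTree A) (h : List A → ℕ) (m : ℕ) : ℝ :=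
  if m = 0 then alphaMinusOne P
  else 1 - ((meanGood P τ).toReal + 1) * (unifSeq {u | hInv τ h m < maxCtx P τ u 0}).toReal

/-- The hypothesis of the first regime: `∑_{k≥1} ∏_{j=0}^{k-1} A_j = +∞`. -/
def DivergentSumProd (a : ℕ → ℝ) : Prop :=
  Tendsto (fun n : ℕ => ∑ k ∈ Finset.Icc 1 n, ∏ j ∈ Finset.range k, a j) atTop atTop

end ContextChain

open ContextChain

/-! The update function reads a letter from `U` whenever `Y` is a letter, and at a star it chooses
the symbol by the residual probabilities `P(·|x) - α(·)`. At a star whose past has the finite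
context `v`, strong local continuity says that the choice only depends on `v` and on the `h v`
symbols before `v`; call `h v` the continuity radius of `v`.

The times are cut, from `0` backwards, into the blocks `θ̄[0], …, 0`, then `θ̄[n], …, n` for the
last time `n` before this block, and so on. At a star of a block all contexts lie in the block, so
that the block is a function of its driving variables and of as many earlier symbols as the largest
continuity radius that its stars may need: its reach. Whether a block is `θ̄[0], …, 0`, and what
its reach is, can be told from the letters and stars in it; hence the blocks are i.i.d.
(`IsBlockEvent.measure_inter`). As each block contains at least one symbol, the symbol at time `0`
is determined by the first `k` blocks as soon as the reach of the `i`-th of them is at most the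
number of those of the `k` blocks that precede it in time (`absCoal_lt_of_renewalAt`).

The `k` with this property form a renewal process with renewal probabilities `g k = ∏_{j<k} b j`,
where `b j` is the probability that the reach is at most `j`. With `r` the tail of the first
renewal, decomposition according to the last renewal up to `n` gives `∑_{k≤n} g k * r (n-k) = 1`.
As `r` is nonincreasing, it tends to zero if `∑ g = ∞`; it is summable if `g` stays away from zero;
and if `1 - b` decays exponentially, then so does `r`, by a renewal equation. Wald's identity and
Chernoff's bound carry the last two facts from the number of blocks over to the number of times.

It remains to see that `A_m ≤ b m` for large `m` (`IsGood.slcSeq_le_reachLE`). The expected number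
of stars in a block that need a continuity radius larger than `m` is at most
`E(|θ̄[0]| + 1) P(Y₀ = ⋆) P(c_τ^0 ≥ h⁻¹(m))`. In a skeleton every internal node lies on an infinite
context, so that a star in the last of the first `k` positions prolongs contexts of length `k`.
Therefore `P(Y₀ = ⋆) P(c_τ^0 ≥ k) ≤ P(c_τ^0 > k)` (`measure_star_inter_le`), which turns the weak
inequality into the strict one of the definition of `A_m`. Finitely many indices do not matter for
the three hypotheses: `b m ≥ α₋₁ > 0` for all `m`, and if stars have positive probability, `A_m` is
eventually positive, although single `A_m` may be negative; without stars `b m = 1` for all `m`. -/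

namespace ContextChain

/-! ### Contexts and skeletons -/

lemma ContextTree.context_mem {A : Type*} (τ : ContextTree A) (x : ℕ → A) :
    τ.context x ∈ τ.carrier :=
  (τ.partition x).choose_spec.1.1

lemma ContextTree.context_isSuffix {A : Type*} (τ : ContextTree A) (x : ℕ → A) :
    (τ.context x).IsSuffix (.inf x) :=
  (τ.partition x).choose_spec.1.2

lemma ContextTree.eq_context {A : Type*} (τ : ContextTree A) {x : ℕ → A} {s : Str A}
    (hs : s ∈ τ.carrier) (hx : s.IsSuffix (.inf x)) : s = τ.context x :=
  (τ.partition x).choose_spec.2 s ⟨hs, hx⟩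

lemma ContextTree.context_congr {A : Type*} (τ : ContextTree A) {x y : ℕ → A} {m : ℕ}
    (hm : (τ.context x).length ≤ m) (hxy : ∀ k < m, x k = y k) :
    τ.context y = τ.context x := by
  have hmem := τ.context_mem x
  have hsuf := τ.context_isSuffix x
  cases hc : τ.context x with
  | inf z => simp [hc, Str.length] at hm
  | fin v =>
    rw [hc] at hm hmem hsuf
    have hv : v.length ≤ m := by simpa [Str.length] using hm
    refine (τ.eq_context hmem fun i hi => ?_).symm
    rw [hsuf i hi, hxy i (hi.trans_le hv)]

lemma isSuffix_of_prefix {A : Type*} {v w : List A} {x : ℕ → A}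
    (hvw : v <+: w) (hw : (Str.fin w).IsSuffix (.inf x)) : (Str.fin v).IsSuffix (.inf x) := by
  intro i hi
  rw [hvw.getElem hi]
  exact hw i _

lemma prefix_of_isSuffix {A : Type*} {v w : List A} {x : ℕ → A}
    (hv : (Str.fin v).IsSuffix (.inf x)) (hw : (Str.fin w).IsSuffix (.inf x))
    (hl : v.length ≤ w.length) : v <+: w := by
  rw [List.prefix_iff_eq_take]
  refine List.ext_getElem (by simpa using hl) fun i h1 h2 => ?_
  rw [List.getElem_take, hv i h1, hw i]

open Classical in
/-- Pruning a context tree at a node `w` no proper suffix of which is a context: all the contexts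
that end with `w` are replaced by `w` itself. -/
def ContextTree.prune {A : Type*} (τ : ContextTree A) (w : List A)
    (hw : ∀ v : List A, Str.fin v ∈ τ.carrier → v <+: w → v = w) : ContextTree A where
  carrier := {s | s = .fin w ∨ (s ∈ τ.carrier ∧ ¬ (Str.fin w).IsSuffix s)}
  partition x := by
    by_cases hx : (Str.fin w).IsSuffix (.inf x)
    · refine ⟨.fin w, ⟨Or.inl rfl, hx⟩, ?_⟩
      rintro s ⟨rfl | ⟨hs, hns⟩, hsx⟩
      · rfl
      · cases s with
        | inf z => cases hsx; exact absurd hx hns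
        | fin v =>
          rcases le_total v.length w.length with hl | hl
          · rw [hw v hs (prefix_of_isSuffix hsx hx hl)]
          · exact absurd (prefix_of_isSuffix hx hsx hl) hns
    · refine ⟨τ.context x, ⟨Or.inr ⟨τ.context_mem x, fun hc => hx ?_⟩, τ.context_isSuffix x⟩, ?_⟩
      · have hsuf := τ.context_isSuffix x
        cases hcx : τ.context x with
        | inf z => rw [hcx] at hsuf hc; cases hsuf; exact hc
        | fin v => rw [hcx] at hsuf hc; exact isSuffix_of_prefix hc hsuf
      · rintro s ⟨rfl | ⟨hs, -⟩, hsx⟩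
        · exact absurd hsx hx
        · exact τ.eq_context hs hsx
  suffix_free := by
    rintro s (rfl | ⟨hs, hns⟩) t (rfl | ⟨ht, hnt⟩) hst
    · rfl
    · exact absurd hst hnt
    · cases s with
      | inf z => exact hst.elim
      | fin v => rw [hw v hs hst]
    · exact τ.suffix_free s hs t ht hst

/-- In a skeleton, the last `k` symbols of a past whose context is longer than `k` are a suffix of
an infinite context: otherwise the tree could be pruned there without losing an infinite context. -/
lemma ContextTree.IsSkeleton.exists_inf {A : Type*} {τ : ContextTree A} (hτ : τ.IsSkeleton)
    {x : ℕ → A} {k : ℕ} (hk : (k : ℕ∞) < (τ.context x).length) :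
    ∃ z : ℕ → A, Str.inf z ∈ τ.carrier ∧ ∀ i < k, z i = x i := by
  by_contra! hcon
  set w : List A := List.ofFn fun i : Fin k => x i with hwdef
  have hwx : (Str.fin w).IsSuffix (.inf x) := fun i hi => by simp [hwdef]
  have hnot : ∀ v : List A, Str.fin v ∈ τ.carrier → ¬ v <+: w := by
    intro v hv hvw
    have h1 := τ.eq_context hv (isSuffix_of_prefix hvw hwx)
    have h2 := hvw.length_le
    rw [← h1] at hk
    simp only [Str.length, hwdef, List.length_ofFn, Nat.cast_lt] at hk h2
    omega
  obtain ⟨v, hv, hvw⟩ := hτ (τ.prune w fun v hv hvw => absurd hvw (hnot v hv))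
    (fun z hz => Or.inr ⟨hz, fun hwz => by
      obtain ⟨i, hi, hne⟩ := hcon z hz
      refine hne ?_
      rw [← hwz i (by simpa [hwdef] using hi)]
      simp [hwdef]⟩) (.fin w) (Or.inl rfl)
  cases v with
  | inf z => exact hvw
  | fin v => exact hnot v hv hvw

/-! ### The letters and stars, and the contexts that they determine -/

section Letters

variable {A : Type*} [Fintype A] [LinearOrder A] {P : TransitionKernel A} {τ : ContextTree A}

lemma context_length_le_maxCtx (u : ℤ → UnitIco) (b : ℤ → A) (n : ℤ) :
    (τ.context (filledPast P u b n)).length ≤ maxCtx P τ u n :=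
  le_iSup (fun b : ℤ → A => (τ.context (filledPast P u b n)).length) b

lemma maxCtx_le_of_agree {u u' : ℤ → UnitIco} {n : ℤ} {m : ℕ} (hm : maxCtx P τ u n ≤ m)
    (hu : ∀ k : ℕ, k < m → letterOf P (u (n - k)) = letterOf P (u' (n - k))) :
    maxCtx P τ u' n ≤ maxCtx P τ u n := by
  refine iSup_le fun b => ?_
  have h1 := context_length_le_maxCtx (P := P) (τ := τ) u b n
  rw [τ.context_congr (y := filledPast P u' b n) (h1.trans hm)
    fun k hk => by simp only [filledPast, hu k hk]]
  exact h1

/-- The event that the contexts before time `n + 1` have length at most `m` is determined by the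
`m` letters or stars up to time `n`, and so is the maximal length on this event. -/
lemma maxCtx_congr {u u' : ℤ → UnitIco} {n : ℤ} {m : ℕ} (hm : maxCtx P τ u n ≤ m)
    (hu : ∀ k : ℕ, k < m → letterOf P (u (n - k)) = letterOf P (u' (n - k))) :
    maxCtx P τ u' n = maxCtx P τ u n :=
  have h1 := maxCtx_le_of_agree hm hu
  h1.antisymm (maxCtx_le_of_agree (h1.trans hm) fun k hk => (hu k hk).symm)

/-- If the contexts of the past up to time `0` may have length `k + 1`, and the symbol at time `-k`,
the oldest of these `k + 1` symbols, is a star, then in a skeleton this star can be filled so that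
the context is even longer: the `k` younger symbols lie on an infinite context. -/
lemma lt_maxCtx_of_star (hτ : τ.IsSkeleton) {u : ℤ → UnitIco} {k : ℕ}
    (hk : ((k + 1 : ℕ) : ℕ∞) ≤ maxCtx P τ u 0) (hstar : letterOf P (u (-k)) = none) :
    ((k + 1 : ℕ) : ℕ∞) < maxCtx P τ u 0 := by
  obtain ⟨b, hb⟩ : ∃ b : ℤ → A, (k : ℕ∞) < (τ.context (filledPast P u b 0)).length := by
    refine lt_iSup_iff.1 (lt_of_lt_of_le ?_ hk)
    exact_mod_cast Nat.lt_succ_self k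
  obtain ⟨z, hz, hzx⟩ := hτ.exists_inf hb
  set b' : ℤ → A := fun i => if i = -k then z k else b i with hb'
  refine lt_of_lt_of_le ?_ (context_length_le_maxCtx u b' 0)
  by_contra! hle
  have hctx := τ.context_congr (y := z) hle fun i hi => by
    rcases Nat.lt_succ_iff_lt_or_eq.1 hi with h1 | rfl
    · have : (-(i : ℤ)) ≠ -k := by omega
      rw [hzx i h1]
      simp [filledPast, hb', this]
    · simp [filledPast, hb', hstar]
  rw [← hctx, ← τ.eq_context (x := z) hz rfl] at hle
  simp [Str.length] at hle

/-! ### Good coalescence times -/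

lemma absMax_le_iff {S : Set ℤ} {n : ℕ} : absMax S ≤ n ↔ ∃ k ≤ n, -(k : ℤ) ∈ S := by
  constructor
  · intro hle
    by_contra! hcon
    have : ((n + 1 : ℕ) : ℕ∞) ≤ absMax S := le_iInf₂ fun k hk => by
      have : ¬ k ≤ n := fun hkn => hcon k hkn hk
      exact_mod_cast (by omega : n + 1 ≤ k)
    have := this.trans hle
    norm_cast at this
    omega
  · rintro ⟨k, hk, hmem⟩
    exact (iInf₂_le k hmem).trans (by exact_mod_cast hk)

lemma absMax_eq_iff {S : Set ℤ} {n : ℕ} :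
    absMax S = n ↔ -(n : ℤ) ∈ S ∧ ∀ k < n, -(k : ℤ) ∉ S := by
  constructor
  · intro heq
    have h2 : ∀ k < n, -(k : ℤ) ∉ S := fun k hk hmem => by
      have := absMax_le_iff.2 ⟨k, le_rfl, hmem⟩
      rw [heq] at this
      norm_cast at this
      omega
    obtain ⟨k, hk, hmem⟩ := absMax_le_iff.1 heq.le
    rcases hk.lt_or_eq with h1 | rfl
    · exact absurd hmem (h2 k h1)
    · exact ⟨hmem, h2⟩
  · rintro ⟨h1, h2⟩
    refine le_antisymm (absMax_le_iff.2 ⟨n, le_rfl, h1⟩) (le_iInf₂ fun k hk => ?_)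
    by_contra! hlt
    exact h2 k (by exact_mod_cast hlt) hk

lemma mem_goodTimes_congr {u u' : ℤ → UnitIco} {l : ℕ}
    (hu : ∀ j : ℕ, j ≤ l → letterOf P (u (-j)) = letterOf P (u' (-j)))
    (hl : -(l : ℤ) ∈ goodTimes P τ u 0) : -(l : ℤ) ∈ goodTimes P τ u' 0 := by
  have hu' : ∀ i : ℤ, -(l : ℤ) ≤ i → i ≤ 0 → letterOf P (u i) = letterOf P (u' i) := by
    intro i h1 h2
    have := hu (-i).toNat (by omega)
    rwa [show -(((-i).toNat : ℕ) : ℤ) = i by omega] at this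
  refine ⟨hl.1, fun j h1 h2 => ?_⟩
  rcases hl.2 j h1 h2 with h3 | h3
  · exact Or.inl (by rwa [← hu' j h1 h2])
  · right
    rw [maxCtx_congr h3 fun k hk => hu' _ (by omega) (by omega)]
    exact h3

/-- The event `|θ̄[0]| = l` is determined by the letters and stars at the times `-l, …, 0`. -/
lemma absGood_congr {u u' : ℤ → UnitIco} {l : ℕ}
    (hu : ∀ j : ℕ, j ≤ l → letterOf P (u (-j)) = letterOf P (u' (-j)))
    (hl : absGood P τ u = l) : absGood P τ u' = l := by
  obtain ⟨h1, h2⟩ := absMax_eq_iff.1 hl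
  exact absMax_eq_iff.2 ⟨mem_goodTimes_congr hu h1, fun k hk hmem =>
    h2 k hk (mem_goodTimes_congr (fun j hj => (hu j (hj.trans hk.le)).symm) hmem)⟩

/-- At a star in the block of the times `θ̄[0], …, 0`, all contexts lie in the block. -/
lemma maxCtx_le_of_star {u : ℤ → UnitIco} {l j : ℕ} (hl : absGood P τ u = l) (hj : j ≤ l)
    (hstar : letterOf P (u (-j)) = none) : maxCtx P τ u (-j - 1) ≤ ((l - j : ℕ) : ℕ∞) := by
  obtain ⟨h1, -⟩ := absMax_eq_iff.1 hl
  rcases h1.2 (-j) (by omega) (by omega) with h3 | h3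
  · exact absurd hstar h3
  · rwa [show (-(j : ℤ) - -(l : ℤ)).toNat = l - j by omega] at h3

lemma absGood_eq_zero {u : ℤ → UnitIco} (hu : letterOf P (u 0) ≠ none) : absGood P τ u = 0 := by
  refine absMax_eq_iff.2 ⟨⟨by simp, fun j h1 h2 => Or.inl ?_⟩, by simp⟩
  obtain rfl : j = 0 := by simpa using le_antisymm h2 (by simpa using h1)
  exact hu

/-! ### Shifts of the driving sequence -/

/-- The driving sequence seen from time `-l`. -/
def shift (l : ℤ) (u : ℤ → UnitIco) : ℤ → UnitIco := fun i => u (i - l)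

lemma maxCtx_shift (l : ℤ) (u : ℤ → UnitIco) (n : ℤ) :
    maxCtx P τ (shift l u) n = maxCtx P τ u (n - l) := by
  have key : ∀ b : ℤ → A,
      filledPast P (shift l u) b n = filledPast P u (fun i => b (i + l)) (n - l) := by
    intro b
    funext k
    simp only [filledPast, shift]
    rw [show n - k - l = n - l - k by ring, show n - l - k + l = n - k by ring]
  refine le_antisymm (iSup_le fun b => ?_) (iSup_le fun b => ?_)
  · rw [key]
    exact context_length_le_maxCtx u _ _
  · have := key fun i => b (i - l)
    simp only [add_sub_cancel_right] at this
    rw [← this]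
    exact context_length_le_maxCtx (shift l u) _ _

end Letters

/-! ### An update function -/

section Update

lemma alphaLetter_nonneg {A : Type*} [Fintype A] {P : TransitionKernel A} (a : A) :
    0 ≤ alphaLetter P a :=
  Real.iInf_nonneg fun z => P.nonneg a z

lemma alphaLetter_le {A : Type*} [Fintype A] {P : TransitionKernel A} (a : A)
    (x : ℕ → A) : alphaLetter P a ≤ P a x :=
  ciInf_le ⟨0, by rintro _ ⟨z, rfl⟩; exact P.nonneg a z⟩ x

lemma alphaMinusOne_le_one {A : Type*} [Fintype A] {P : TransitionKernel A}
    [Nonempty A] : alphaMinusOne P ≤ 1 := by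
  have x : ℕ → A := fun _ => Classical.arbitrary A
  rw [← P.sum_eq_one x]
  exact Finset.sum_le_sum fun a _ => alphaLetter_le a x

variable {A : Type*} [Fintype A] [LinearOrder A]

lemma sum_le_le_sum_lt (w : A → ℝ) (hw : ∀ a, 0 ≤ w a) {a b : A} (hab : a < b) :
    ∑ j with j ≤ a, w j ≤ ∑ j with j < b, w j :=
  Finset.sum_le_sum_of_subset_of_nonneg
    (fun j hj => by simp only [Finset.mem_filter] at hj ⊢; exact ⟨hj.1, hj.2.trans_lt hab⟩)
    fun j _ _ => hw j

lemma sum_le_eq_sum_lt_add (w : A → ℝ) (a : A) :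
    ∑ j with j ≤ a, w j = ∑ j with j < a, w j + w a := by
  have : Finset.univ.filter (fun j => j ≤ a) = insert a (Finset.univ.filter fun j => j < a) := by
    ext j
    simp [le_iff_eq_or_lt]
  rw [this, Finset.sum_insert (by simp), add_comm]

/-- The intervals cut out by the partial sums of nonnegative weights are disjoint. -/
lemma eq_of_mem_partialSums (w : A → ℝ) (hw : ∀ a, 0 ≤ w a) {c u : ℝ} {a b : A}
    (ha : c + ∑ j with j < a, w j ≤ u ∧ u < c + ∑ j with j ≤ a, w j)
    (hb : c + ∑ j with j < b, w j ≤ u ∧ u < c + ∑ j with j ≤ b, w j) : a = b := by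
  rcases lt_trichotomy a b with h | h | h
  · linarith [sum_le_le_sum_lt w hw h]
  · exact h
  · linarith [sum_le_le_sum_lt w hw h]

/-- The intervals cut out by the partial sums of nonnegative weights cover. -/
lemma exists_mem_partialSums (w : A → ℝ) {c u : ℝ} (h1 : c ≤ u) (h2 : u < c + ∑ a, w a) :
    ∃ a : A, c + ∑ j with j < a, w j ≤ u ∧ u < c + ∑ j with j ≤ a, w j := by
  have hA : Nonempty A := by
    by_contra hA
    rw [not_nonempty_iff] at hA
    rw [Finset.univ_eq_empty, Finset.sum_empty] at h2
    linarith
  let S : Finset A := Finset.univ.filter fun a => u < c + ∑ j with j ≤ a, w j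
  have hS : S.Nonempty := by
    obtain ⟨M, -, hM⟩ := (Finset.univ : Finset A).exists_max_image id Finset.univ_nonempty
    refine ⟨M, Finset.mem_filter.2 ⟨Finset.mem_univ _, ?_⟩⟩
    rwa [Finset.filter_true_of_mem (p := fun j => j ≤ M) fun j _ => hM j (Finset.mem_univ _)]
  refine ⟨S.min' hS, ?_, (Finset.mem_filter.1 (S.min'_mem hS)).2⟩
  rcases (Finset.univ.filter fun j => j < S.min' hS).eq_empty_or_nonempty with he | hne
  · rw [he]
    simpa using h1
  · set p := (Finset.univ.filter fun j => j < S.min' hS).max' hne with hp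
    have hpm : p < S.min' hS := (Finset.mem_filter.1 (Finset.max'_mem _ hne)).2
    have heq : (Finset.univ.filter fun j => j < S.min' hS) = Finset.univ.filter fun j => j ≤ p := by
      ext j
      simp only [Finset.mem_filter, Finset.mem_univ, true_and]
      exact ⟨fun hj => Finset.le_max' _ _ (by simpa using hj), fun hj => hj.trans_lt hpm⟩
    rw [heq]
    by_contra! hlt
    exact absurd (S.min'_le p (by simpa [S] using hlt)) (not_le.2 hpm)

variable {P : TransitionKernel A}

lemma letterOf_eq_some_iff {u : UnitIco} {a : A} :
    letterOf P u = some a ↔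
      ∑ j with j < a, alphaLetter P j ≤ (u : ℝ) ∧ (u : ℝ) < ∑ j with j ≤ a, alphaLetter P j := by
  classical
  unfold letterOf
  constructor
  · intro h
    split_ifs at h with hex
    cases h
    exact hex.choose_spec
  · intro h
    rw [dif_pos ⟨a, h⟩]
    congr 1
    have h' := (⟨a, h⟩ : ∃ a : A, ∑ j with j < a, alphaLetter P j ≤ (u : ℝ) ∧
      (u : ℝ) < ∑ j with j ≤ a, alphaLetter P j).choose_spec
    exact eq_of_mem_partialSums (c := 0) (alphaLetter P) alphaLetter_nonneg
      (by simpa using h') (by simpa using h)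

lemma letterOf_eq_none_iff {u : UnitIco} : letterOf P u = none ↔ alphaMinusOne P ≤ u := by
  constructor
  · intro h
    by_contra! hlt
    obtain ⟨a, ha⟩ := exists_mem_partialSums (c := 0) (alphaLetter P) u.2.1
      (by simpa [alphaMinusOne] using hlt)
    rw [letterOf_eq_some_iff.2 (by simpa using ha)] at h
    cases h
  · intro h
    cases hl : letterOf P u with
    | none => rfl
    | some a =>
      have h1 := (letterOf_eq_some_iff.1 hl).2
      have h2 : ∑ j with j ≤ a, alphaLetter P j ≤ alphaMinusOne P :=
        Finset.sum_le_sum_of_subset_of_nonneg (Finset.filter_subset _ _)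
          fun j _ _ => alphaLetter_nonneg j
      linarith

/-- `a` is the symbol that the residual probabilities `P(·|x) - α(·)`, laid out as consecutive
intervals on the right of `α₋₁`, assign to `u`. -/
def IsResidual (P : TransitionKernel A) (x : ℕ → A) (u : UnitIco) (a : A) : Prop :=
  alphaMinusOne P + ∑ j with j < a, (P j x - alphaLetter P j) ≤ (u : ℝ) ∧
    (u : ℝ) < alphaMinusOne P + ∑ j with j ≤ a, (P j x - alphaLetter P j)

lemma residual_nonneg {A : Type*} [Fintype A] {P : TransitionKernel A} (x : ℕ → A)
    (a : A) : 0 ≤ P a x - alphaLetter P a :=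
  sub_nonneg.2 (alphaLetter_le a x)

lemma IsResidual.alphaMinusOne_le {x : ℕ → A} {u : UnitIco} {a : A} (h : IsResidual P x u a) :
    alphaMinusOne P ≤ u := by
  refine le_trans ?_ h.1
  simpa using Finset.sum_nonneg fun j _ => residual_nonneg x j

lemma exists_isResidual {u : UnitIco} (hu : alphaMinusOne P ≤ u) (x : ℕ → A) :
    ∃ a, IsResidual P x u a :=
  exists_mem_partialSums _ hu (by
    rw [Finset.sum_sub_distrib, P.sum_eq_one]
    simpa [alphaMinusOne] using u.2.2)

open Classical in
/-- The update function: the letter read off from `u` if there is one, and the symbol chosen by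
the residual probabilities at a star. -/
noncomputable def update (P : TransitionKernel A) (x : ℕ → A) (u : UnitIco) : A :=
  if h : ∃ a, letterOf P u = some a ∨ IsResidual P x u a then h.choose else x 0

lemma update_spec (x : ℕ → A) (u : UnitIco) :
    letterOf P u = some (update P x u) ∨ IsResidual P x u (update P x u) := by
  have h : ∃ a, letterOf P u = some a ∨ IsResidual P x u a := by
    cases hl : letterOf P u with
    | some a => exact ⟨a, Or.inl rfl⟩
    | none =>
      obtain ⟨a, ha⟩ := exists_isResidual (letterOf_eq_none_iff.1 hl) x
      exact ⟨a, Or.inr ha⟩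
  rw [update, dif_pos h]
  exact h.choose_spec

lemma update_eq_iff {x : ℕ → A} {u : UnitIco} {a : A} :
    update P x u = a ↔ letterOf P u = some a ∨ IsResidual P x u a := by
  refine ⟨fun h => h ▸ update_spec x u, fun h => ?_⟩
  have hno : ∀ {b c : A}, letterOf P u = some b → IsResidual P x u c → False := fun hb hc => by
    rw [letterOf_eq_none_iff.2 hc.alphaMinusOne_le] at hb
    cases hb
  rcases h with h | h <;> rcases update_spec (P := P) x u with h' | h'
  · exact Option.some_injective _ (h'.symm.trans h)
  · exact (hno h h').elim
  · exact (hno h' h).elim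
  · exact eq_of_mem_partialSums _ (residual_nonneg x) h' h

lemma update_of_letter {u : UnitIco} {a : A} (h : letterOf P u = some a) (x : ℕ → A) :
    update P x u = a :=
  update_eq_iff.2 (Or.inl h)

lemma update_congr {x y : ℕ → A} (hxy : ∀ a, P a x = P a y) (u : UnitIco) :
    update P x u = update P y u := by
  refine update_eq_iff.2 ((update_spec y u).imp id fun h => ?_)
  simpa only [IsResidual, hxy] using h

lemma unif_Ico {a b : ℝ} (ha : 0 ≤ a) (hb : b ≤ 1) :
    unif {s : UnitIco | a ≤ (s : ℝ) ∧ (s : ℝ) < b} = ENNReal.ofReal (b - a) := by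
  rw [unif, comap_subtype_coe_apply measurableSet_Ico]
  have : ((↑) : UnitIco → ℝ) '' {s : UnitIco | a ≤ (s : ℝ) ∧ (s : ℝ) < b} = Set.Ico a b := by
    ext r
    simp only [Set.mem_image, Set.mem_ofPred_eq, Set.mem_Ico]
    constructor
    · rintro ⟨s, hs, rfl⟩
      exact hs
    · exact fun hr => ⟨⟨r, ha.trans hr.1, hr.2.trans_le hb⟩, hr, rfl⟩
  rw [this, Real.volume_Ico]

lemma measurableSet_coe_Ico (a b : ℝ) :
    MeasurableSet {s : UnitIco | a ≤ (s : ℝ) ∧ (s : ℝ) < b} :=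
  measurable_subtype_coe measurableSet_Ico

lemma isUpdate_update (P : TransitionKernel A) : IsUpdate P (update P) := by
  intro x a
  have : Nonempty A := ⟨a⟩
  have hset : {s | update P x s = a} =
      {s : UnitIco | ∑ j with j < a, alphaLetter P j ≤ (s : ℝ) ∧
        (s : ℝ) < ∑ j with j ≤ a, alphaLetter P j} ∪
      {s : UnitIco | alphaMinusOne P + ∑ j with j < a, (P j x - alphaLetter P j) ≤ (s : ℝ) ∧
        (s : ℝ) < alphaMinusOne P + ∑ j with j ≤ a, (P j x - alphaLetter P j)} := by
    ext s
    simp only [Set.mem_ofPred_eq, Set.mem_union, update_eq_iff, letterOf_eq_some_iff, IsResidual]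
  have hα : ∑ j with j ≤ a, alphaLetter P j ≤ alphaMinusOne P :=
    Finset.sum_le_sum_of_subset_of_nonneg (Finset.filter_subset _ _)
      fun j _ _ => alphaLetter_nonneg j
  have h0 : 0 ≤ ∑ j with j < a, alphaLetter P j := Finset.sum_nonneg fun j _ => alphaLetter_nonneg j
  have h0' : 0 ≤ ∑ j with j < a, (P j x - alphaLetter P j) :=
    Finset.sum_nonneg fun j _ => residual_nonneg x j
  have hr : ∑ j with j ≤ a, (P j x - alphaLetter P j) ≤ 1 - alphaMinusOne P := by
    rw [← P.sum_eq_one x, alphaMinusOne, ← Finset.sum_sub_distrib]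
    exact Finset.sum_le_sum_of_subset_of_nonneg (Finset.filter_subset _ _)
      fun j _ _ => residual_nonneg x j
  have hα1 := alphaMinusOne_le_one (P := P)
  have hα0 : 0 ≤ alphaMinusOne P := Finset.sum_nonneg fun j _ => alphaLetter_nonneg j
  refine ⟨hset ▸ (measurableSet_coe_Ico _ _).union (measurableSet_coe_Ico _ _), ?_⟩
  rw [hset, measure_union ?_ (measurableSet_coe_Ico _ _), unif_Ico h0 (hα.trans hα1),
    unif_Ico (by positivity) (by linarith),
    sum_le_eq_sum_lt_add (alphaLetter P), sum_le_eq_sum_lt_add (fun j => P j x - alphaLetter P j),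
    ← ENNReal.ofReal_add]
  · congr 1
    ring
  · simpa using alphaLetter_nonneg a
  · simpa using alphaLetter_le a x
  · refine Set.disjoint_left.2 fun s hs hs' => ?_
    have := hs.2
    have := hs'.1
    linarith

/-! ### Strong local continuity -/

/-- At a finite context `v` the transition probabilities only depend on the context and on the
`h v` symbols that precede it. -/
lemma IsSLCWith.congr {A : Type*} [Fintype A] {P : TransitionKernel A} {τ : ContextTree A}
    {h : List A → ℕ} (hP : IsSLCWith P τ h) {v : List A}
    (hv : Str.fin v ∈ τ.carrier) {x y : ℕ → A} (hx : (Str.fin v).IsSuffix (.inf x))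
    (hxy : ∀ k < v.length + h v, x k = y k) (a : A) : P a x = P a y := by
  set k := h v
  set w : Fin k → A := fun i => x (v.length + i)
  have hval := (hP v hv).2 k le_rfl
  have hbdd : ∀ (f : (ℕ → A) → (ℕ → A)) (a : A), BddBelow (Set.range fun z => P a (f z)) :=
    fun f a => ⟨0, by rintro _ ⟨z, rfl⟩; exact P.nonneg a _⟩
  have hge : 1 ≤ ∑ a, ⨅ z : ℕ → A, P a (append (v ++ List.ofFn w) z) := by
    rw [← hval]
    exact ciInf_le (Set.finite_range _).bddBelow w
  have happ : ∀ y : ℕ → A, (∀ k < v.length + h v, x k = y k) →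
      append (v ++ List.ofFn w) (fun i => y (i + (v.length + k))) = y := by
    intro y hy
    funext i
    unfold append
    split_ifs with hi
    · have hi' : i < v.length + k := by simpa using hi
      rw [← hy i hi']
      by_cases hiv : i < v.length
      · rw [List.getElem_append_left hiv]
        exact hx i hiv
      · rw [List.getElem_append_right (by omega)]
        simp only [List.getElem_ofFn, w]
        congr 1
        omega
    · simp only [List.length_append, List.length_ofFn] at hi ⊢
      rw [Nat.sub_add_cancel (not_lt.1 hi)]
  have key : ∀ y : ℕ → A, (∀ k < v.length + h v, x k = y k) →
      P a y = ⨅ z : ℕ → A, P a (append (v ++ List.ofFn w) z) := by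
    intro y hy
    have hle : ∀ a, ⨅ z : ℕ → A, P a (append (v ++ List.ofFn w) z) ≤ P a y := fun a => by
      have := ciInf_le (hbdd (append (v ++ List.ofFn w)) a) fun i => y (i + (v.length + k))
      rwa [happ y hy] at this
    refine (((Finset.sum_eq_sum_iff_of_le fun a _ => hle a).1 ?_) a (Finset.mem_univ a)).symm
    refine le_antisymm (Finset.sum_le_sum fun a _ => hle a) ?_
    rw [P.sum_eq_one]
    exact hge
  rw [key x fun _ _ => rfl, key y hxy]

end Update

/-! ### Runs of the chain -/

section Runs

variable {A : Type*}

@[simp] lemma append_singleton_zero (a : A) (z : ℕ → A) : append [a] z 0 = a := by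
  simp [append]

@[simp] lemma append_singleton_succ (a : A) (z : ℕ → A) (i : ℕ) :
    append [a] z (i + 1) = z i := by
  simp [append]

lemma runPast_shift (F : (ℕ → A) → UnitIco → A) (x : ℕ → A) (u : ℤ → UnitIco) (l j : ℤ) (n : ℕ) :
    runPast F x (shift l u) j n = runPast F x u (j - l) n := by
  induction n with
  | zero => rfl
  | succ n ih =>
    simp only [runPast, ih, shift]
    rw [show j + n - l = j - l + n by ring]

lemma runPast_add (F : (ℕ → A) → UnitIco → A) (x : ℕ → A) (u : ℤ → UnitIco) (j : ℤ) (m n : ℕ) :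
    runPast F x u j (m + n) = runPast F (runPast F x u j m) u (j + m) n := by
  induction n with
  | zero => rfl
  | succ n ih =>
    rw [← add_assoc]
    simp only [runPast, ih]
    rw [show j + m + n = j + ((m + n : ℕ) : ℤ) by push_cast; ring]

lemma iter_shift (F : (ℕ → A) → UnitIco → A) (x : ℕ → A) (u : ℤ → UnitIco) (l j k : ℤ) :
    iter F x (shift l u) j k = iter F x u (j - l) (k - l) := by
  simp only [iter, runPast_shift, sub_sub_sub_cancel_right, shift]

lemma iter_eq_runPast (F : (ℕ → A) → UnitIco → A) (x : ℕ → A) (u : ℤ → UnitIco) (n : ℕ) :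
    iter F x u (-n) 0 = runPast F x u (-n) (n + 1) 0 := by
  simp [iter, runPast]

/-- Times before a coalescence time are coalescence times. -/
lemma mem_coalTimes_of_le {F : (ℕ → A) → UnitIco → A} {u : ℤ → UnitIco} {m n i j : ℤ}
    (hj : j ∈ coalTimes F u m n) (hij : i ≤ j) : i ∈ coalTimes F u m n := by
  refine ⟨hij.trans hj.1, fun k h1 h2 x y => ?_⟩
  have key : ∀ x : ℕ → A, iter F x u i k = iter F (runPast F x u i (j - i).toNat) u j k := by
    intro x
    have := hj.1
    rw [iter, iter, show (k - i).toNat = (j - i).toNat + (k - j).toNat by omega, runPast_add,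
      show i + ((j - i).toNat : ℤ) = j by omega]
  rw [key x, key y]
  exact hj.2 k h1 h2 _ _

/-- If the symbol at each time has a coalescence time, then so have all finite windows. -/
lemma coalTimes_nonempty {F : (ℕ → A) → UnitIco → A} {u : ℤ → UnitIco}
    (hu : ∀ k : ℤ, absCoal F (shift k u) < ⊤) (m n : ℤ) : (coalTimes F u m n).Nonempty := by
  have hk : ∀ k : ℤ, (coalTimes F u k k).Nonempty := by
    intro k
    obtain ⟨N, hN⟩ := ENat.ne_top_iff_exists.1 (hu (-k)).ne
    obtain ⟨j, -, hj⟩ := absMax_le_iff.1 (show absMax _ ≤ (N : ℕ∞) from hN.ge)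
    refine ⟨-j + k, ?_, fun i h1 h2 x y => ?_⟩
    · have := hj.1
      omega
    · obtain rfl := le_antisymm h1 h2
      have := hj.2 0 le_rfl le_rfl x y
      simpa [iter_shift] using this
  choose c hc using hk
  set s := insert m ((Finset.Icc m n).image c) with hs
  have hne : s.Nonempty := ⟨m, by simp [hs]⟩
  refine ⟨s.min' hne, s.min'_le m (by simp [hs]), fun k h1 h2 x y => ?_⟩
  have hle : s.min' hne ≤ c k := s.min'_le _
    (Finset.mem_insert_of_mem (Finset.mem_image_of_mem c (Finset.mem_Icc.2 ⟨h1, h2⟩)))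
  exact (mem_coalTimes_of_le (hc k) hle).2 k le_rfl le_rfl x y

end Runs

/-! ### Blocks -/

section Blocks

variable {A : Type*} [Fintype A] [LinearOrder A]

/-- The number of times in the block `θ̄[0], …, 0` (with the junk value `1` if `|θ̄[0]| = ∞`). -/
noncomputable def blockLen (P : TransitionKernel A) (τ : ContextTree A) (u : ℤ → UnitIco) : ℕ :=
  (absGood P τ u).toNat + 1

/-- The driving sequence seen from the last time before the block `θ̄[0], …, 0`. -/
noncomputable def nextBlock (P : TransitionKernel A) (τ : ContextTree A) (u : ℤ → UnitIco) :
    ℤ → UnitIco :=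
  shift (blockLen P τ u) u

/-- The event that `θ̄[0]` is finite and that all contexts that may occur at the stars of the block
`θ̄[0], …, 0` have continuity radius at most `m`: the symbols of the block then depend on at most
`m` symbols that precede it. -/
def reachLE (P : TransitionKernel A) (τ : ContextTree A) (h : List A → ℕ) (m : ℕ) :
    Set (ℤ → UnitIco) :=
  {u | absGood P τ u < ⊤ ∧ ∀ j : ℕ, (j : ℕ∞) ≤ absGood P τ u → letterOf P (u (-j)) = none →
    ∀ v : List A, Str.fin v ∈ τ.carrier → (v.length : ℕ∞) ≤ maxCtx P τ u (-j - 1) → h v ≤ m}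

variable {P : TransitionKernel A} {τ : ContextTree A} {h : List A → ℕ}

lemma reachLE_mono {m n : ℕ} (hmn : m ≤ n) : reachLE P τ h m ⊆ reachLE P τ h n :=
  fun _ hu => ⟨hu.1, fun j hj hs v hv hl => (hu.2 j hj hs v hv hl).trans hmn⟩

lemma runPast_update_letter (x : ℕ → A) (u : ℤ → UnitIco) (j : ℤ) :
    ∀ (n k : ℕ) (a : A), k < n → letterOf P (u (j + n - 1 - k)) = some a →
      runPast (update P) x u j n k = a
  | 0, _, _, hk, _ => absurd hk (Nat.not_lt_zero _)
  | n + 1, 0, a, _, hl => by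
    simp only [runPast, append_singleton_zero]
    refine update_of_letter ?_ _
    convert hl using 3
    push_cast
    ring
  | n + 1, k + 1, a, hk, hl => by
    simp only [runPast, append_singleton_succ]
    refine runPast_update_letter x u j n k a (by omega) ?_
    convert hl using 3
    push_cast
    ring

/-- Two pasts before a block that agree on `M ≥ m` symbols, where `m` bounds the continuity radii in
the block, still agree when the block is appended. -/
lemma runPast_block (hP : IsSLCWith P τ h) {u : ℤ → UnitIco} {m M : ℕ} (hu : u ∈ reachLE P τ h m)
    (hmM : m ≤ M) {x y : ℕ → A} (hxy : ∀ k < M, x k = y k) :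
    ∀ k < M + blockLen P τ u, runPast (update P) x u (-(blockLen P τ u - 1)) (blockLen P τ u) k =
      runPast (update P) y u (-(blockLen P τ u - 1)) (blockLen P τ u) k := by
  obtain ⟨l, hl⟩ := ENat.ne_top_iff_exists.1 hu.1.ne
  have hlen : blockLen P τ u = l + 1 := by rw [blockLen, ← hl]; rfl
  rw [hlen]
  have hst : -((((l + 1 : ℕ)) : ℤ) - 1) = -(l : ℤ) := by push_cast; ring
  rw [hst]
  suffices ∀ t ≤ l + 1, ∀ k < M + t, runPast (update P) x u (-l) t k =
      runPast (update P) y u (-l) t k from this _ le_rfl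
  intro t
  induction t with
  | zero => exact fun _ => hxy
  | succ t ih =>
    intro ht k hk
    have ih := ih (by omega)
    have hstep : update P (runPast (update P) x u (-l) t) (u (-l + t)) =
        update P (runPast (update P) y u (-l) t) (u (-l + t)) := by
      cases hlet : letterOf P (u (-l + t)) with
      | some a => rw [update_of_letter hlet, update_of_letter hlet]
      | none =>
        have htime : (-(l : ℤ) + t) = -((l - t : ℕ) : ℤ) := by omega
        rw [htime] at hlet
        have hmax := maxCtx_le_of_star hl.symm (by omega) hlet
        set p := runPast (update P) x u (-l) t with hp
        -- The run itself is one of the fillings of the stars in the block.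
        set b : ℤ → A := fun i => p (-((l - t : ℕ) : ℤ) - 1 - i).toNat with hb
        have hfill : ∀ k < t, filledPast P u b (-((l - t : ℕ) : ℤ) - 1) k = p k := by
          intro k hk
          cases hk' : letterOf P (u (-((l - t : ℕ) : ℤ) - 1 - k)) with
          | some a =>
            simp only [filledPast, hk', Option.getD_some]
            refine (runPast_update_letter x u (-l) t k a hk ?_).symm
            rw [← hk', htime]
          | none => simp [filledPast, hk', hb]
        have hctx := context_length_le_maxCtx (P := P) (τ := τ) u b (-((l - t : ℕ) : ℤ) - 1)
        rw [show l - (l - t) = t by omega] at hmax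
        have hcp := τ.context_congr (hctx.trans hmax) hfill
        have hmem := τ.context_mem p
        have hsuf := τ.context_isSuffix p
        rw [← hcp] at hctx
        cases hc : τ.context p with
        | inf z =>
          rw [hc] at hctx
          simpa [Str.length] using hctx.trans hmax
        | fin v =>
          rw [hc] at hctx hmem hsuf
          simp only [Str.length] at hctx
          have h1 := hu.2 (l - t) (by rw [← hl]; exact_mod_cast Nat.sub_le l t) hlet v hmem hctx
          have h2 : v.length ≤ t := by exact_mod_cast hctx.trans hmax
          exact update_congr (hP.congr hmem hsuf fun i hi => ih i (by omega)) _
    rcases k with _ | k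
    · simpa only [runPast, append_singleton_zero] using hstep
    · simpa only [runPast, append_singleton_succ] using ih k (by omega)

end Blocks

/-! ### Renewal sequences -/

section RenewalSequence

variable {b r : ℕ → ℝ}

lemma prod_range_antitone (hb0 : ∀ j, 0 ≤ b j) (hb1 : ∀ j, b j ≤ 1) :
    Antitone fun n => ∏ j ∈ Finset.range n, b j :=
  antitone_nat_of_succ_le fun n => by
    rw [Finset.prod_range_succ]
    exact mul_le_of_le_one_right (Finset.prod_nonneg fun j _ => hb0 j) (hb1 n)

/-- The partial products of numbers in `]0,1]` that approach `1` summably are bounded away from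
zero. -/
lemma exists_pos_le_prod (hb0 : ∀ j, 0 < b j) (hb1 : ∀ j, b j ≤ 1)
    (hb : Summable fun j => 1 - b j) : ∃ γ > 0, ∀ n, γ ≤ ∏ j ∈ Finset.range n, b j := by
  obtain ⟨M, hM⟩ : ∃ M, ∀ n, ∑ j ∈ Finset.range n, (1 - b (M + j)) ≤ 1 / 2 := by
    have h1 := tendsto_sum_nat_add fun j => 1 - b j
    obtain ⟨M, hM⟩ := (h1.eventually (ge_mem_nhds (by norm_num : (0 : ℝ) < 1 / 2))).exists
    refine ⟨M, fun n => le_trans ?_ hM⟩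
    simp_rw [add_comm M]
    exact ((summable_nat_add_iff M).2 hb).sum_le_tsum _ fun j _ => sub_nonneg.2 (hb1 _)
  have htail : ∀ n, 1 - ∑ j ∈ Finset.range n, (1 - b (M + j)) ≤
      ∏ j ∈ Finset.range n, b (M + j) := by
    intro n
    induction n with
    | zero => simp
    | succ n ih =>
      rw [Finset.sum_range_succ, Finset.prod_range_succ]
      have h1 : ∏ j ∈ Finset.range n, b (M + j) ≤ 1 :=
        Finset.prod_le_one (fun j _ => (hb0 _).le) fun j _ => hb1 _
      nlinarith [hb1 (M + n)]
  have hpos : 0 < ∏ j ∈ Finset.range M, b j := Finset.prod_pos fun j _ => hb0 j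
  refine ⟨(∏ j ∈ Finset.range M, b j) * (1 / 2), by positivity, fun n => ?_⟩
  refine le_trans ?_ (prod_range_antitone (fun j => (hb0 j).le) hb1 (Nat.le_add_left n M))
  simp only [Finset.prod_range_add]
  refine mul_le_mul_of_nonneg_left ?_ hpos.le
  linarith [htail n, hM n]

/-- If the renewal probabilities have infinite sum, the tail of the renewal time tends to zero. -/
lemma tendsto_renewal_tail {g : ℕ → ℝ} (hr0 : ∀ n, 0 ≤ r n) (hr : Antitone r) (hg : ∀ n, 0 ≤ g n)
    (hren : ∀ n, ∑ k ∈ Finset.range (n + 1), g k * r (n - k) = 1)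
    (hdiv : Tendsto (fun n => ∑ k ∈ Finset.range n, g k) atTop atTop) :
    Tendsto r atTop (𝓝 0) := by
  have hle : ∀ n, (∑ k ∈ Finset.range (n + 1), g k) * r n ≤ 1 := fun n => by
    rw [← hren n, Finset.sum_mul]
    exact Finset.sum_le_sum fun k _ => mul_le_mul_of_nonneg_left (hr (Nat.sub_le n k)) (hg k)
  have hdiv' := hdiv.comp (tendsto_add_atTop_nat 1)
  refine squeeze_zero' (Eventually.of_forall hr0) ?_ hdiv'.inv_tendsto_atTop
  filter_upwards [hdiv'.eventually_gt_atTop 0] with n hn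
  simp only [Function.comp_apply, Pi.inv_apply] at hn ⊢
  rw [← one_div, le_div_iff₀ hn, mul_comm]
  exact hle n

/-- If the renewal probabilities are bounded away from zero, the renewal time has summable tail. -/
lemma summable_renewal_tail {g : ℕ → ℝ} {γ : ℝ} (hγ : 0 < γ) (hr0 : ∀ n, 0 ≤ r n)
    (hg : ∀ n, γ ≤ g n) (hren : ∀ n, ∑ k ∈ Finset.range (n + 1), g k * r (n - k) = 1) :
    Summable r := by
  refine summable_of_sum_range_le (c := 1 / γ) hr0 fun n => ?_
  have h1 : γ * ∑ k ∈ Finset.range (n + 1), r k ≤ 1 := by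
    rw [← hren n, ← Finset.sum_range_reflect, Finset.mul_sum]
    refine Finset.sum_le_sum fun k _ => ?_
    rw [show n + 1 - 1 - k = n - k by omega]
    exact mul_le_mul_of_nonneg_right (hg k) (hr0 _)
  rw [le_div_iff₀ hγ, mul_comm]
  refine le_trans (mul_le_mul_of_nonneg_left ?_ hγ.le) h1
  rw [Finset.sum_range_succ]
  linarith [hr0 n]

/-- If the renewal probabilities `∏_{j<k} b_j` converge to a positive limit exponentially fast, the
renewal time has an exponential tail: the tail solves a renewal equation whose weights have
exponential decay and total mass less than one. -/
lemma expDecay_renewal_tail (hr0 : r 0 = 1) (hb0 : ∀ j, 0 < b j) (hb1 : ∀ j, b j ≤ 1)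
    (hb : ExpDecay fun j => 1 - b j)
    (hren : ∀ n, ∑ k ∈ Finset.range (n + 1), (∏ j ∈ Finset.range k, b j) * r (n - k) = 1) :
    ExpDecay r := by
  obtain ⟨D, d, hD, hd0, hd1, hbd⟩ := hb
  set g : ℕ → ℝ := fun k => ∏ j ∈ Finset.range k, b j with hg
  have hg0 : ∀ k, 0 < g k := fun k => Finset.prod_pos fun j _ => hb0 j
  have hganti : Antitone g := prod_range_antitone (fun j => (hb0 j).le) hb1
  set e : ℕ → ℝ := fun j => g j - g (j + 1) with he
  have he0 : ∀ j, 0 ≤ e j := fun j => sub_nonneg.2 (hganti (Nat.le_succ j))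
  have hed : ∀ j, e j ≤ D * d ^ j := fun j => by
    have h1 : e j = g j * (1 - b j) := by
      simp only [he, hg, Finset.prod_range_succ]
      ring
    have h2 : g j ≤ 1 := Finset.prod_le_one (fun j _ => (hb0 j).le) fun j _ => hb1 j
    rw [h1]
    exact (mul_le_of_le_one_left (sub_nonneg.2 (hb1 j)) h2).trans (hbd j)
  have hsumb : Summable fun j => 1 - b j :=
    Summable.of_nonneg_of_le (fun j => sub_nonneg.2 (hb1 j)) hbd
      ((summable_geometric_of_lt_one hd0.le hd1).mul_left D)
  obtain ⟨γ, hγ, hγg⟩ := exists_pos_le_prod hb0 hb1 hsumb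
  have hsume : ∑' j, e j < 1 := by
    have : ∑' j, e j ≤ 1 - γ := Real.tsum_le_of_sum_range_le he0 fun n => by
      rw [Finset.sum_range_sub']
      have := hγg n
      simp only [hg, Finset.range_zero, Finset.prod_empty] at this ⊢
      linarith
    linarith
  -- By dominated convergence the weights `e j` still have mass at most one when they are
  -- multiplied by `x ^ (j + 1)`, for some `x > 1`.
  obtain ⟨x, hx1, hxsum, hxle⟩ : ∃ x : ℝ, 1 < x ∧ Summable (fun j => e j * x ^ (j + 1)) ∧
      ∑' j, e j * x ^ (j + 1) < 1 := by
    set x₀ : ℝ := 2 / (1 + d) with hx₀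
    have hx₀1 : 1 < x₀ := by rw [hx₀, lt_div_iff₀ (by linarith)]; linarith
    have hx₀d : d * x₀ < 1 := by
      rw [hx₀, mul_div_assoc', div_lt_one (by linarith)]; linarith
    have hbound : Summable fun j => D * x₀ * (d * x₀) ^ j :=
      (summable_geometric_of_lt_one (by positivity) hx₀d).mul_left _
    have hle : ∀ x : ℝ, 0 ≤ x → x ≤ x₀ → ∀ j, e j * x ^ (j + 1) ≤ D * x₀ * (d * x₀) ^ j := by
      intro x hx hxx j
      calc e j * x ^ (j + 1) ≤ (D * d ^ j) * x₀ ^ (j + 1) :=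
            mul_le_mul (hed j) (pow_le_pow_left₀ hx hxx _) (by positivity) (by positivity)
        _ = _ := by rw [mul_pow]; ring
    have hlim : Tendsto (fun x : ℝ => ∑' j, e j * x ^ (j + 1)) (𝓝[>] 1) (𝓝 (∑' j, e j * 1)) := by
      refine tendsto_tsum_of_dominated_convergence hbound (fun j => ?_) ?_
      · have : ContinuousAt (fun x : ℝ => e j * x ^ (j + 1)) 1 := by fun_prop
        simpa using this.tendsto.mono_left nhdsWithin_le_nhds
      · filter_upwards [Ioo_mem_nhdsGT hx₀1] with x hx j
        have hx0 : 0 ≤ x := by linarith [hx.1]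
        rw [Real.norm_of_nonneg (mul_nonneg (he0 j) (by positivity))]
        exact hle x hx0 hx.2.le j
    simp only [mul_one] at hlim
    have hev : ∀ᶠ x in 𝓝[>] (1 : ℝ), x ∈ Set.Ioo 1 x₀ := Ioo_mem_nhdsGT hx₀1
    obtain ⟨x, hx, hxlt⟩ := (hev.and (hlim.eventually (gt_mem_nhds hsume))).exists
    have hx0 : 0 ≤ x := by linarith [hx.1]
    exact ⟨x, hx.1, Summable.of_nonneg_of_le (fun j => mul_nonneg (he0 j) (by positivity))
      (hle x hx0 hx.2.le) hbound, hxlt⟩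
  have hx0 : 0 < x := by linarith
  have hrec : ∀ n, r (n + 1) = ∑ j ∈ Finset.range (n + 1), e j * r (n - j) := by
    intro n
    have h1 := hren (n + 1)
    rw [Finset.sum_range_succ'] at h1
    have h2 := hren n
    simp only [Finset.range_zero, Finset.prod_empty, one_mul, Nat.sub_zero,
      Nat.add_sub_add_right] at h1
    simp only [he, hg, sub_mul, Finset.sum_sub_distrib]
    linarith
  refine ⟨1, x⁻¹, one_pos, by positivity, inv_lt_one_of_one_lt₀ hx1, fun n => ?_⟩
  rw [one_mul]
  induction n using Nat.strong_induction_on with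
  | _ n ih =>
    rcases n with _ | n
    · simp [hr0]
    · rw [hrec]
      calc ∑ j ∈ Finset.range (n + 1), e j * r (n - j)
          ≤ ∑ j ∈ Finset.range (n + 1), x⁻¹ ^ (n + 1) * (e j * x ^ (j + 1)) := by
            refine Finset.sum_le_sum fun j hj => ?_
            have hj' : j ≤ n := Nat.lt_succ_iff.1 (Finset.mem_range.1 hj)
            refine (mul_le_mul_of_nonneg_left (ih (n - j) (by omega)) (he0 j)).trans_eq ?_
            rw [mul_left_comm]
            congr 1
            rw [show n + 1 = (n - j) + (j + 1) by omega, pow_add, mul_assoc, ← mul_pow,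
              inv_mul_cancel₀ hx0.ne', one_pow, mul_one]
        _ ≤ x⁻¹ ^ (n + 1) * 1 := by
            rw [← Finset.mul_sum]
            refine mul_le_mul_of_nonneg_left (le_trans ?_ hxle.le) (by positivity)
            exact hxsum.sum_le_tsum _ fun j _ => mul_nonneg (he0 j) (by positivity)
        _ = _ := mul_one _

end RenewalSequence

/-! ### Renewal events along an orbit -/

section RenewalEvents

variable {Ω : Type*}

/-- The event that a renewal takes place at `k`. If `Q m` is the event that the reach of a point is
at most `m`, this means that none of the points `T^[0] u, …, T^[k-1] u` reaches beyond them: the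
reach of the `i`-th one is at most `k - 1 - i`, the number of those after it. -/
def renewalAt (T : Ω → Ω) (Q : ℕ → Set Ω) (k : ℕ) : Set Ω :=
  {u | ∀ i < k, T^[i] u ∈ Q (k - 1 - i)}

/-- No renewal takes place at `1, …, n`. -/
def noRenewal (T : Ω → Ω) (Q : ℕ → Set Ω) (n : ℕ) : Set Ω :=
  {u | ∀ k, 1 ≤ k → k ≤ n → u ∉ renewalAt T Q k}

variable {T : Ω → Ω} {Q : ℕ → Set Ω}

lemma renewalAt_zero : renewalAt T Q 0 = Set.univ := by
  simp [renewalAt]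

lemma noRenewal_zero : noRenewal T Q 0 = Set.univ :=
  Set.eq_univ_of_forall fun u k h1 h2 => by omega

lemma noRenewal_antitone : Antitone (noRenewal T Q) :=
  fun _ _ hmn _ hu k h1 h2 => hu k h1 (h2.trans hmn)

lemma renewalAt_succ (k : ℕ) : renewalAt T Q (k + 1) = Q k ∩ T ⁻¹' renewalAt T Q k := by
  ext u
  constructor
  · intro hu
    refine ⟨by simpa using hu 0 (Nat.succ_pos k), fun i hi => ?_⟩
    have := hu (i + 1) (by omega)
    rwa [Function.iterate_succ_apply, show k + 1 - 1 - (i + 1) = k - 1 - i by omega] at this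
  · rintro ⟨h1, h2⟩ i hi
    rcases i with _ | i
    · simpa using h1
    · have := h2 i (by omega)
      rwa [Function.iterate_succ_apply, show k + 1 - 1 - (i + 1) = k - 1 - i by omega]

/-- Given a renewal at `k`, the later renewals are those of the orbit that starts at `k`. -/
lemma mem_renewalAt_add (hQ : Monotone Q) {u : Ω} {k m : ℕ} (hu : u ∈ renewalAt T Q k) :
    u ∈ renewalAt T Q (k + m) ↔ T^[k] u ∈ renewalAt T Q m := by
  constructor
  · intro h i hi
    have := h (k + i) (by omega)
    rwa [add_comm k i, Function.iterate_add_apply,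
      show k + m - 1 - (i + k) = m - 1 - i by omega] at this
  · intro h i hi
    rcases lt_or_ge i k with hik | hik
    · exact hQ (by omega) (hu i hik)
    · have := h (i - k) (by omega)
      rwa [← Function.iterate_add_apply, Nat.sub_add_cancel hik,
        show m - 1 - (i - k) = k + m - 1 - i by omega] at this

variable {mΩ : MeasurableSpace Ω} {μ : Measure Ω}

lemma measurableSet_renewalAt (hT : Measurable T) (hQ : ∀ m, MeasurableSet (Q m)) (k : ℕ) :
    MeasurableSet (renewalAt T Q k) := by
  induction k with
  | zero => rw [renewalAt_zero]; exact MeasurableSet.univ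
  | succ k ih => rw [renewalAt_succ]; exact (hQ k).inter (hT ih)

lemma measurableSet_noRenewal (hT : Measurable T) (hQ : ∀ m, MeasurableSet (Q m)) (n : ℕ) :
    MeasurableSet (noRenewal T Q n) := by
  have : noRenewal T Q n = ⋂ k ∈ Finset.Icc 1 n, (renewalAt T Q k)ᶜ := by
    ext u
    simp [noRenewal]
  rw [this]
  exact Finset.measurableSet_biInter _ fun k _ => (measurableSet_renewalAt hT hQ k).compl

lemma measure_renewalAt_inter (hT : Measurable T) (hQ : ∀ m, MeasurableSet (Q m))
    (hind : ∀ m D, MeasurableSet D → μ (Q m ∩ T ⁻¹' D) = μ (Q m) * μ D) (k : ℕ) {C : Set Ω}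
    (hC : MeasurableSet C) :
    μ (renewalAt T Q k ∩ T^[k] ⁻¹' C) = (∏ j ∈ Finset.range k, μ (Q j)) * μ C := by
  induction k with
  | zero => simp [renewalAt_zero]
  | succ k ih =>
    rw [renewalAt_succ, Function.iterate_succ, Set.preimage_comp, Set.inter_assoc,
      ← Set.preimage_inter, hind _ _ ((measurableSet_renewalAt hT hQ k).inter
        ((hT.iterate k) hC)), ih, Finset.prod_range_succ, ← mul_assoc]
    ring

/-- Decomposition according to the last renewal up to `n`. -/
lemma sum_measure_last_renewal (hT : MeasurePreserving T μ μ) (hQ : ∀ m, MeasurableSet (Q m))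
    (hmono : Monotone Q)
    (hind : ∀ m D, MeasurableSet D → μ (Q m ∩ T ⁻¹' D) = μ (Q m) * μ D) (n : ℕ) {C : Set Ω}
    (hC : MeasurableSet C) :
    ∑ k ∈ Finset.range (n + 1), (∏ j ∈ Finset.range k, μ (Q j)) *
      μ (noRenewal T Q (n - k) ∩ T^[n - k] ⁻¹' C) = μ C := by
  have hTm := hT.measurable
  have hmeas : ∀ k, MeasurableSet (noRenewal T Q (n - k) ∩ T^[n - k] ⁻¹' C) := fun k =>
    (measurableSet_noRenewal hTm hQ _).inter ((hTm.iterate _) hC)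
  rw [← (hT.iterate n).measure_preimage hC.nullMeasurableSet]
  simp_rw [← fun k => measure_renewalAt_inter hTm hQ hind k (hmeas k)]
  rw [← measure_biUnion_finset]
  · congr 1
    ext u
    simp only [Set.mem_iUnion, Finset.mem_range, Set.mem_inter_iff, Set.mem_preimage]
    constructor
    · rintro ⟨k, hk, -, -, h3⟩
      rwa [← Function.iterate_add_apply, Nat.sub_add_cancel (by omega)] at h3
    · intro hu
      classical
      set s := (Finset.range (n + 1)).filter fun k => u ∈ renewalAt T Q k with hs
      have hne : s.Nonempty := ⟨0, by simp [hs, renewalAt_zero]⟩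
      obtain ⟨h1, h2⟩ := Finset.mem_filter.1 (s.max'_mem hne)
      have h1' := Finset.mem_range.1 h1
      refine ⟨s.max' hne, h1', h2, fun k hk1 hk2 hmem => ?_, ?_⟩
      · have := s.le_max' (s.max' hne + k) (Finset.mem_filter.2
          ⟨Finset.mem_range.2 (by omega), (mem_renewalAt_add hmono h2).2 hmem⟩)
        omega
      · rwa [← Function.iterate_add_apply, Nat.sub_add_cancel (by omega)]
  · have key : ∀ k k', k < k' → k' < n + 1 →
        Disjoint (renewalAt T Q k ∩ T^[k] ⁻¹' (noRenewal T Q (n - k) ∩ T^[n - k] ⁻¹' C))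
          (renewalAt T Q k' ∩ T^[k'] ⁻¹' (noRenewal T Q (n - k') ∩ T^[n - k'] ⁻¹' C)) := by
      intro k k' hkk hk'
      refine Set.disjoint_left.2 fun u hu hu' => hu.2.1 (k' - k) (by omega) (by omega) ?_
      rw [← mem_renewalAt_add hmono hu.1, show k + (k' - k) = k' by omega]
      exact hu'.1
    intro k hk k' hk' hne
    simp only [Finset.coe_range, Set.mem_Iio] at hk hk'
    rcases lt_or_gt_of_ne hne with h | h
    · exact key k k' h hk'
    · exact (key k' k h hk).symm
  · exact fun k _ => (measurableSet_renewalAt hTm hQ k).inter ((hTm.iterate k) (hmeas k))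

/-- Whether a renewal takes place up to `n` is independent of the orbit from `n` on. -/
lemma measure_noRenewal_inter [IsProbabilityMeasure μ] (hT : MeasurePreserving T μ μ)
    (hQ : ∀ m, MeasurableSet (Q m)) (hmono : Monotone Q)
    (hind : ∀ m D, MeasurableSet D → μ (Q m ∩ T ⁻¹' D) = μ (Q m) * μ D) (n : ℕ) {C : Set Ω}
    (hC : MeasurableSet C) :
    μ (noRenewal T Q n ∩ T^[n] ⁻¹' C) = μ (noRenewal T Q n) * μ C := by
  induction n using Nat.strong_induction_on with
  | _ n ih =>
    have h1 := sum_measure_last_renewal hT hQ hmono hind n hC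
    have h2 := sum_measure_last_renewal hT hQ hmono hind n MeasurableSet.univ
    simp only [Set.preimage_univ, Set.inter_univ, measure_univ] at h2
    rw [Finset.sum_range_succ'] at h1 h2
    simp only [Finset.range_zero, Finset.prod_empty, one_mul, Nat.sub_zero] at h1 h2
    rw [Finset.sum_congr rfl fun k _ => by rw [ih (n - (k + 1)) (by
      have := Finset.mem_range.1 ‹_›; omega), ← mul_assoc], ← Finset.sum_mul] at h1
    set S := ∑ k ∈ Finset.range n, (∏ j ∈ Finset.range (k + 1), μ (Q j)) *
      μ (noRenewal T Q (n - (k + 1)))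
    have hfin : S * μ C ≠ ⊤ := by
      refine ENNReal.mul_ne_top (ne_top_of_le_ne_top ENNReal.one_ne_top ?_) (measure_ne_top μ C)
      rw [← h2]
      exact le_self_add
    refine (ENNReal.add_right_inj hfin).1 ?_
    rw [h1, ← add_mul, h2, one_mul]

lemma sum_real_last_renewal [IsProbabilityMeasure μ] (hT : MeasurePreserving T μ μ)
    (hQ : ∀ m, MeasurableSet (Q m)) (hmono : Monotone Q)
    (hind : ∀ m D, MeasurableSet D → μ (Q m ∩ T ⁻¹' D) = μ (Q m) * μ D) (n : ℕ) :
    ∑ k ∈ Finset.range (n + 1), (∏ j ∈ Finset.range k, μ.real (Q j)) *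
      μ.real (noRenewal T Q (n - k)) = 1 := by
  have h := congrArg ENNReal.toReal
    (sum_measure_last_renewal hT hQ hmono hind n MeasurableSet.univ)
  rw [ENNReal.toReal_sum fun k _ => ENNReal.mul_ne_top
    (ENNReal.prod_ne_top fun j _ => measure_ne_top μ _) (measure_ne_top μ _)] at h
  simpa [ENNReal.toReal_mul, ENNReal.toReal_prod, Measure.real] using h

/-- One summand of Wald's identity. -/
lemma setLIntegral_noRenewal [IsProbabilityMeasure μ] (hT : MeasurePreserving T μ μ)
    (hQ : ∀ m, MeasurableSet (Q m)) (hmono : Monotone Q)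
    (hind : ∀ m D, MeasurableSet D → μ (Q m ∩ T ⁻¹' D) = μ (Q m) * μ D) (n : ℕ) {f : Ω → ℝ≥0∞}
    (hf : Measurable f) :
    ∫⁻ u in noRenewal T Q n, f (T^[n] u) ∂μ = μ (noRenewal T Q n) * ∫⁻ u, f u ∂μ := by
  have hTn := hT.measurable.iterate n
  have hmap : (μ.restrict (noRenewal T Q n)).map T^[n] = μ (noRenewal T Q n) • μ := by
    ext C hC
    rw [Measure.map_apply hTn hC, Measure.restrict_apply (hTn hC), Set.inter_comm,
      measure_noRenewal_inter hT hQ hmono hind n hC]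
    rfl
  rw [← lintegral_map hf hTn, hmap, lintegral_smul_measure, smul_eq_mul]

end RenewalEvents

/-! ### Coalescence at renewals of the blocks -/

section Coalescence

variable {A : Type*} [Fintype A] [LinearOrder A] {P : TransitionKernel A} {τ : ContextTree A}
  {h : List A → ℕ}

/-- The symbols of the first `k` blocks do not depend on what precedes them, if the reach of each
of these blocks is at most the number of those of them that precede it. -/
lemma runPast_renewalAt (hP : IsSLCWith P τ h) (x y : ℕ → A) (k : ℕ) :
    ∀ u ∈ renewalAt (nextBlock P τ) (reachLE P τ h) k,
      ∀ N, N = ∑ i ∈ Finset.range k, blockLen P τ ((nextBlock P τ)^[i] u) →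
        ∀ t < N, runPast (update P) x u (-(N - 1)) N t = runPast (update P) y u (-(N - 1)) N t := by
  induction k with
  | zero =>
    rintro u - N rfl t ht
    simp at ht
  | succ k ih =>
    rintro u hu N hN t ht
    rw [renewalAt_succ] at hu
    set l := blockLen P τ u with hl
    set N' := ∑ i ∈ Finset.range k, blockLen P τ ((nextBlock P τ)^[i] (nextBlock P τ u)) with hN'
    have hNN : N = N' + l := by
      rw [hN, Finset.sum_range_succ']
      rfl
    have hkN : k ≤ N' := by
      calc k = ∑ i ∈ Finset.range k, 1 := by simp
        _ ≤ N' := Finset.sum_le_sum fun i _ => Nat.succ_le_succ (Nat.zero_le _)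
    have hagree := ih (nextBlock P τ u) hu.2 N' rfl
    simp only [nextBlock, runPast_shift] at hagree
    have h1 : (-((N' : ℤ) - 1) - (blockLen P τ u : ℤ)) = -((N : ℤ) - 1) := by
      rw [hNN, ← hl]; push_cast; ring
    have h2 : -((N : ℤ) - 1) + N' = -((l : ℤ) - 1) := by
      rw [hNN]; push_cast; ring
    rw [h1] at hagree
    have := runPast_block hP hu.1 hkN hagree t (by rw [← hl, ← hNN]; exact ht)
    rw [← hl, ← h2, ← runPast_add, ← runPast_add, ← hNN] at this
    exact this

lemma absCoal_lt_of_renewalAt (hP : IsSLCWith P τ h) {u : ℤ → UnitIco} {k : ℕ} (hk : k ≠ 0)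
    (hu : u ∈ renewalAt (nextBlock P τ) (reachLE P τ h) k) :
    absCoal (update P) u <
      ((∑ i ∈ Finset.range k, blockLen P τ ((nextBlock P τ)^[i] u) : ℕ) : ℕ∞) := by
  set N := ∑ i ∈ Finset.range k, blockLen P τ ((nextBlock P τ)^[i] u) with hN
  have hpos : 0 < N := Finset.sum_pos (fun i _ => Nat.succ_pos _) (by simpa using hk)
  obtain ⟨n, hn⟩ := Nat.exists_eq_add_of_lt hpos
  rw [zero_add] at hn
  have hle : absCoal (update P) u ≤ n := by
    refine absMax_le_iff.2 ⟨n, le_rfl, by simp, fun i h1 h2 x y => ?_⟩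
    obtain rfl := le_antisymm h2 h1
    rw [iter_eq_runPast, iter_eq_runPast]
    have := runPast_renewalAt hP x y k u hu N hN 0 hpos
    rw [hn] at this
    simpa using this
  refine hle.trans_lt ?_
  rw [hn]
  exact_mod_cast Nat.lt_succ_self n

end Coalescence

/-! ### Independence and stationarity of the driving sequence -/

section Driving

instance : IsProbabilityMeasure unifSeq := by
  unfold unifSeq
  infer_instance

/-- The σ-algebra of the driving variables at the times in `I`. -/
abbrev timesAlg (I : Set ℤ) : MeasurableSpace (ℤ → UnitIco) :=
  ⨆ i ∈ I, MeasurableSpace.comap (fun u : ℤ → UnitIco => u i) inferInstance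

lemma timesAlg_le (I : Set ℤ) : timesAlg I ≤ MeasurableSpace.pi :=
  iSup₂_le fun i _ => (measurable_pi_apply i).comap_le

lemma timesAlg_mono {I J : Set ℤ} (h : I ⊆ J) : timesAlg I ≤ timesAlg J :=
  biSup_mono h

lemma measurable_eval_timesAlg {I : Set ℤ} {i : ℤ} (hi : i ∈ I) :
    Measurable[timesAlg I] fun u : ℤ → UnitIco => u i :=
  measurable_iff_comap_le.2
    (le_iSup₂_of_le (f := fun i (_ : i ∈ I) =>
      MeasurableSpace.comap (fun u : ℤ → UnitIco => u i) inferInstance) i hi le_rfl)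

lemma measure_inter_of_disjoint_times {I J : Set ℤ} (hIJ : Disjoint I J)
    {G D : Set (ℤ → UnitIco)} (hG : MeasurableSet[timesAlg I] G)
    (hD : MeasurableSet[timesAlg J] D) :
    unifSeq (G ∩ D) = unifSeq G * unifSeq D := by
  have hind : ProbabilityTheory.iIndep (fun i : ℤ =>
      MeasurableSpace.comap (fun u : ℤ → UnitIco => u i) inferInstance) unifSeq :=
    ProbabilityTheory.iIndepFun_infinitePi (P := fun _ : ℤ => unif) (X := fun _ s => s)
      fun _ => measurable_id
  exact (ProbabilityTheory.Indep_iff _ _ _).1 (ProbabilityTheory.indep_iSup_of_disjoint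
    (fun i => (measurable_pi_apply i).comap_le) hind hIJ) G D hG hD

lemma measurable_shift_timesAlg {l : ℤ} {I J : Set ℤ} (h : ∀ j ∈ J, j - l ∈ I) :
    @Measurable _ _ (timesAlg I) (timesAlg J) (shift l) := by
  refine measurable_iff_comap_le.2 ?_
  simp only [timesAlg, MeasurableSpace.comap_iSup, MeasurableSpace.comap_comp]
  refine iSup₂_le fun j hj => ?_
  exact measurable_iff_comap_le.1 (measurable_eval_timesAlg (h j hj))

lemma measurePreserving_shift (l : ℤ) : MeasurePreserving (shift l) unifSeq unifSeq := by
  refine ⟨measurable_pi_lambda _ fun i => measurable_pi_apply _, ?_⟩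
  have h := Measure.infinitePi_map_piCongrLeft (fun _ : ℤ => unif) (Equiv.addRight l)
  have hfun : (MeasurableEquiv.piCongrLeft (fun _ : ℤ => UnitIco) (Equiv.addRight l) :
      (ℤ → UnitIco) → ℤ → UnitIco) = shift l := by
    funext u i
    obtain ⟨j, rfl⟩ := (Equiv.addRight l).surjective i
    rw [MeasurableEquiv.coe_piCongrLeft, Equiv.piCongrLeft_apply_apply]
    simp [shift]
  rw [hfun] at h
  exact h

variable {A : Type*} [Fintype A] [LinearOrder A] {P : TransitionKernel A}

lemma measurableSet_letterOf_eq (o : Option A) :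
    MeasurableSet {s : UnitIco | letterOf P s = o} := by
  cases o with
  | none =>
    simp only [letterOf_eq_none_iff]
    exact measurable_subtype_coe measurableSet_Ici
  | some a =>
    simp only [letterOf_eq_some_iff]
    exact measurableSet_coe_Ico _ _

/-- An event determined by the letters and stars at finitely many times is measurable with respect
to these times. -/
lemma measurableSet_of_letters (I : Finset ℤ) {G : Set (ℤ → UnitIco)}
    (hG : ∀ u ∈ G, ∀ u', (∀ i ∈ I, letterOf P (u i) = letterOf P (u' i)) → u' ∈ G) :
    MeasurableSet[timesAlg I] G := by
  set φ : (ℤ → UnitIco) → I → Option A := fun u i => letterOf P (u i) with hφ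
  have hset : G = ⋃ c ∈ φ '' G, ⋂ i : I, {u | letterOf P (u i) = c i} := by
    ext u
    simp only [Set.mem_iUnion, Set.mem_iInter, Set.mem_ofPred_eq]
    constructor
    · exact fun hu => ⟨φ u, ⟨u, hu, rfl⟩, fun i => rfl⟩
    · rintro ⟨_, ⟨v, hv, rfl⟩, hc⟩
      exact hG v hv u fun i hi => (hc ⟨i, hi⟩).symm
  rw [hset]
  refine (Set.toFinite (φ '' G)).measurableSet_biUnion fun c _ => ?_
  refine MeasurableSet.iInter fun i => ?_
  exact measurable_eval_timesAlg (I := (I : Set ℤ)) i.2 (measurableSet_letterOf_eq (c i))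

lemma unifSeq_eval (i : ℤ) {S : Set UnitIco} (hS : MeasurableSet S) :
    unifSeq {u | u i ∈ S} = unif S :=
  (measurePreserving_eval_infinitePi (fun _ : ℤ => unif) i).measure_preimage hS.nullMeasurableSet

end Driving

/-! ### Blocks are independent and identically distributed -/

section Blocks

variable {A : Type*} [Fintype A] [LinearOrder A] {P : TransitionKernel A} {τ : ContextTree A}
  {h : List A → ℕ}

/-- The σ-algebra of the driving variables up to time `0`. -/
abbrev pastAlg : MeasurableSpace (ℤ → UnitIco) := timesAlg (Set.Iic 0)

/-- The law of the driving sequence up to time `0`. -/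
noncomputable def pastLaw : @Measure (ℤ → UnitIco) pastAlg :=
  unifSeq.trim (timesAlg_le _)

instance : IsProbabilityMeasure pastLaw :=
  ⟨by rw [pastLaw, trim_measurableSet_eq _ MeasurableSet.univ, measure_univ]⟩

lemma pastLaw_apply {G : Set (ℤ → UnitIco)} (hG : MeasurableSet[pastAlg] G) :
    pastLaw G = unifSeq G :=
  trim_measurableSet_eq _ hG

/-- Events on which `θ̄[0]` is finite and that are determined by the letters and stars of the block
`θ̄[0], …, 0`. -/
def IsBlockEvent (P : TransitionKernel A) (τ : ContextTree A) (G : Set (ℤ → UnitIco)) : Prop :=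
  ∀ u ∈ G, absGood P τ u < ⊤ ∧ ∀ u',
    (∀ j : ℕ, (j : ℕ∞) ≤ absGood P τ u → letterOf P (u (-j)) = letterOf P (u' (-j))) → u' ∈ G

lemma isBlockEvent_absGood_mem (S : Set ℕ) :
    IsBlockEvent P τ {u | ∃ l ∈ S, absGood P τ u = (l : ℕ∞)} := by
  rintro u ⟨l, hlS, hl⟩
  refine ⟨hl ▸ ENat.natCast_lt_top l, fun u' hu' =>
    ⟨l, hlS, absGood_congr (fun j hj => hu' j ?_) hl⟩⟩
  rw [hl]
  exact_mod_cast hj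

lemma isBlockEvent_reachLE (m : ℕ) : IsBlockEvent P τ (reachLE P τ h m) := by
  refine fun u hu => ⟨hu.1, fun u' hu' => ?_⟩
  obtain ⟨l, hl⟩ := ENat.ne_top_iff_exists.1 hu.1.ne
  have hle : ∀ {j : ℕ}, (j : ℕ∞) ≤ absGood P τ u ↔ j ≤ l := fun {j} => by
    rw [← hl]
    exact_mod_cast Iff.rfl
  have hl' := absGood_congr (fun j hj => hu' j (hle.2 hj)) hl.symm
  refine ⟨hl' ▸ ENat.natCast_lt_top l, fun j hj hs v hv hvl => ?_⟩
  rw [hl', hl] at hj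
  have hs' := hs
  rw [← hu' j hj] at hs'
  refine hu.2 j hj hs' v hv (hvl.trans_eq ?_)
  refine maxCtx_congr (maxCtx_le_of_star hl.symm (hle.1 hj) hs') fun k hk => ?_
  have := hu' (j + 1 + k) (hle.2 (by omega))
  rwa [show -(((j + 1 + k : ℕ)) : ℤ) = -j - 1 - k by push_cast; ring] at this

lemma IsBlockEvent.measurableSet_inter {G : Set (ℤ → UnitIco)} (hG : IsBlockEvent P τ G) (l : ℕ) :
    MeasurableSet[timesAlg (Set.Icc (-l : ℤ) 0)] (G ∩ {u | absGood P τ u = (l : ℕ∞)}) := by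
  have := measurableSet_of_letters (P := P) (Finset.Icc (-l : ℤ) 0)
    (G := G ∩ {u | absGood P τ u = (l : ℕ∞)}) ?_
  · rwa [Finset.coe_Icc] at this
  · rintro u ⟨hu, hl⟩ u' hu'
    have hag : ∀ j : ℕ, j ≤ l → letterOf P (u (-j)) = letterOf P (u' (-j)) := fun j hj =>
      hu' _ (Finset.mem_Icc.2 ⟨by omega, by omega⟩)
    refine ⟨(hG u hu).2 u' fun j hj => hag j ?_, absGood_congr hag hl⟩
    rw [hl] at hj
    exact_mod_cast hj

lemma IsBlockEvent.eq_iUnion {G : Set (ℤ → UnitIco)} (hG : IsBlockEvent P τ G) :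
    G = ⋃ l : ℕ, G ∩ {u | absGood P τ u = (l : ℕ∞)} := by
  ext u
  simp only [Set.mem_iUnion, Set.mem_inter_iff, Set.mem_ofPred_eq, exists_and_left]
  refine ⟨fun hu => ⟨hu, ?_⟩, fun hu => hu.1⟩
  obtain ⟨l, hl⟩ := ENat.ne_top_iff_exists.1 (hG u hu).1.ne
  exact ⟨l, hl.symm⟩

lemma IsBlockEvent.measurableSet {G : Set (ℤ → UnitIco)} (hG : IsBlockEvent P τ G) :
    MeasurableSet[pastAlg] G := by
  rw [hG.eq_iUnion]
  exact MeasurableSet.iUnion fun l => timesAlg_mono Set.Icc_subset_Iic_self _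
    (hG.measurableSet_inter l)

lemma measurable_absGood : Measurable[pastAlg] (absGood P τ) := by
  refine (@ENat.measurable_iff _ pastAlg _).2 fun n => ?_
  have := (isBlockEvent_absGood_mem (P := P) (τ := τ) {n}).measurableSet
  simpa [Set.preimage] using this

lemma measurable_blockLen : Measurable[pastAlg] (blockLen P τ) :=
  fun s _ => measurable_absGood (P := P) (τ := τ)
    (show MeasurableSet ((fun n : ℕ∞ => n.toNat + 1) ⁻¹' s) from trivial)

lemma measurable_nextBlock : @Measurable _ _ pastAlg pastAlg (nextBlock P τ) := by
  intro D hD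
  have hset : nextBlock P τ ⁻¹' D =
      ⋃ l : ℕ, blockLen P τ ⁻¹' {l} ∩ shift l ⁻¹' D := by
    ext u
    simp [nextBlock]
  rw [hset]
  refine MeasurableSet.iUnion fun l => (measurable_blockLen (measurableSet_singleton l)).inter ?_
  refine measurable_shift_timesAlg (fun j hj => ?_) hD
  simp only [Set.mem_Iic] at hj ⊢
  omega

/-- The block `θ̄[0], …, 0` is independent of what precedes it, which has the law of the driving
sequence up to time `0`. -/
lemma IsBlockEvent.measure_inter {G D : Set (ℤ → UnitIco)} (hG : IsBlockEvent P τ G)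
    (hD : MeasurableSet[pastAlg] D) :
    unifSeq (G ∩ nextBlock P τ ⁻¹' D) = unifSeq G * unifSeq D := by
  have hfull : ∀ l : ℕ, MeasurableSet (G ∩ {u | absGood P τ u = (l : ℕ∞)}) := fun l =>
    timesAlg_le _ _ (hG.measurableSet_inter l)
  have hdisj : Pairwise (Function.onFun Disjoint
      fun l : ℕ => G ∩ {u | absGood P τ u = (l : ℕ∞)}) := fun l l' hne =>
    Set.disjoint_left.2 fun u hu hu' => hne (by exact_mod_cast hu.2.symm.trans hu'.2)
  have hset : G ∩ nextBlock P τ ⁻¹' D =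
      ⋃ l : ℕ, (G ∩ {u | absGood P τ u = (l : ℕ∞)}) ∩ shift ((l + 1 : ℕ) : ℤ) ⁻¹' D := by
    conv_lhs => rw [hG.eq_iUnion, Set.iUnion_inter]
    refine Set.iUnion_congr fun l => ?_
    ext u
    simp only [Set.mem_inter_iff, Set.mem_ofPred_eq, Set.mem_preimage, and_congr_right_iff, and_imp]
    intro _ hl
    simp [nextBlock, blockLen, hl]
  have hDm : MeasurableSet D := timesAlg_le _ _ hD
  have hshift : ∀ l : ℕ, MeasurableSet (shift ((l + 1 : ℕ) : ℤ) ⁻¹' D) := fun l =>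
    (measurePreserving_shift _).measurable hDm
  rw [hset, measure_iUnion
    (fun l l' hne => (hdisj hne).mono Set.inter_subset_left Set.inter_subset_left)
    fun l => (hfull l).inter (hshift l)]
  conv_rhs => rw [hG.eq_iUnion, measure_iUnion hdisj hfull, ← ENNReal.tsum_mul_right]
  refine tsum_congr fun l => ?_
  rw [measure_inter_of_disjoint_times (I := Set.Icc (-l : ℤ) 0) (J := Set.Iic (-l - 1 : ℤ)) ?_
    (hG.measurableSet_inter l) (measurable_shift_timesAlg (fun j hj => ?_) hD),
    (measurePreserving_shift _).measure_preimage hDm.nullMeasurableSet]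
  · refine Set.disjoint_left.2 fun i hi hi' => ?_
    have := hi.1
    simp only [Set.mem_Iic] at hi'
    omega
  · simp only [Set.mem_Iic] at hj ⊢
    push_cast
    omega

lemma measurable_coe_absGood :
    Measurable fun u => ((absGood P τ u : ℕ∞) : ℝ≥0∞) := fun s _ =>
  timesAlg_le _ _ (measurable_absGood (P := P) (τ := τ)
    (show MeasurableSet ((fun n : ℕ∞ => (n : ℝ≥0∞)) ⁻¹' s) from trivial))

lemma IsGood.ae_lt_top (hgood : IsGood P τ) : ∀ᵐ u ∂unifSeq, absGood P τ u < ⊤ := by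
  filter_upwards [MeasureTheory.ae_lt_top measurable_coe_absGood (ne_of_lt hgood)] with u hu
  refine lt_top_iff_ne_top.2 fun h => ?_
  simp [h] at hu

lemma IsGood.measure_inter (hgood : IsGood P τ) (G : Set (ℤ → UnitIco)) :
    unifSeq ({u | absGood P τ u < ⊤} ∩ G) = unifSeq G := by
  refine measure_congr ?_
  filter_upwards [hgood.ae_lt_top] with u hu
  exact propext ⟨fun h => h.2, fun h => ⟨hu, h⟩⟩

lemma isBlockEvent_absGood_lt_top : IsBlockEvent P τ {u | absGood P τ u < ⊤} := by
  have := isBlockEvent_absGood_mem (P := P) (τ := τ) Set.univ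
  convert this using 3 with u
  simp [ENat.ne_top_iff_exists, lt_top_iff_ne_top, eq_comm]

lemma IsGood.measurePreserving_nextBlock (hgood : IsGood P τ) :
    @MeasurePreserving _ _ pastAlg pastAlg (nextBlock P τ) pastLaw pastLaw := by
  refine @MeasurePreserving.mk _ _ pastAlg pastAlg _ _ _ measurable_nextBlock ?_
  refine @Measure.ext _ pastAlg _ _ fun D hD => ?_
  rw [@Measure.map_apply _ _ pastAlg pastAlg _ _ measurable_nextBlock _ hD,
    pastLaw_apply (measurable_nextBlock hD), pastLaw_apply hD]
  have h1 := isBlockEvent_absGood_lt_top.measure_inter (P := P) (τ := τ) hD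
  have h2 := hgood.measure_inter Set.univ
  rw [Set.inter_univ, measure_univ] at h2
  rwa [hgood.measure_inter, h2, one_mul] at h1

/-- The length of a block is independent of what precedes the block. -/
lemma IsGood.lintegral_blockLen_mul (hgood : IsGood P τ) (φ : ℕ → ℝ≥0∞)
    {f : (ℤ → UnitIco) → ℝ≥0∞} (hf : Measurable[pastAlg] f) :
    ∫⁻ u, φ (blockLen P τ u) * f (nextBlock P τ u) ∂pastLaw =
      (∫⁻ u, φ (blockLen P τ u) ∂pastLaw) * ∫⁻ u, f u ∂pastLaw := by
  have hT := hgood.measurePreserving_nextBlock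
  have hind : @ProbabilityTheory.IndepFun _ _ _ pastAlg _ pastAlg (blockLen P τ)
      (nextBlock P τ) pastLaw := by
    rw [ProbabilityTheory.indepFun_iff_measure_inter_preimage_eq_mul]
    intro s D _ hD
    have hset : {u | ∃ l ∈ {l : ℕ | l + 1 ∈ s}, absGood P τ u = (l : ℕ∞)} =
        {u | absGood P τ u < ⊤} ∩ blockLen P τ ⁻¹' s := by
      ext u
      cases hu : absGood P τ u with
      | top => simp [hu]
      | coe l => simp [hu, blockLen]
    have h1 := (isBlockEvent_absGood_mem (P := P) (τ := τ) {l | l + 1 ∈ s}).measure_inter hD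
    have hs : MeasurableSet[pastAlg] (blockLen P τ ⁻¹' s) :=
      measurable_blockLen (P := P) (τ := τ) (by trivial)
    rw [hset, Set.inter_assoc, hgood.measure_inter, hgood.measure_inter, ← pastLaw_apply hs,
      ← pastLaw_apply hD, ← pastLaw_apply (hs.inter (measurable_nextBlock hD))] at h1
    rw [h1, @MeasurePreserving.measure_preimage _ _ pastAlg pastAlg _ _ _ hT _
      (@MeasurableSet.nullMeasurableSet _ pastAlg _ _ hD)]
  have hφ : Measurable φ := measurable_from_top
  have h := ProbabilityTheory.lintegral_mul_eq_lintegral_mul_lintegral_of_indepFun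
    (hφ.comp measurable_blockLen) (hf.comp measurable_nextBlock) (hind.comp hφ hf)
  simp only [Pi.mul_apply, Function.comp_apply] at h
  rw [h, @MeasurePreserving.lintegral_comp _ _ pastAlg pastAlg _ _ _ hT _ hf]

/-- The sum of the lengths of the first `k` blocks is a sum of independent copies. -/
lemma IsGood.lintegral_pow_sum_blockLen (hgood : IsGood P τ) (s : ℝ≥0∞) (k : ℕ) :
    ∫⁻ u, s ^ (∑ i ∈ Finset.range k, blockLen P τ ((nextBlock P τ)^[i] u)) ∂pastLaw =
      (∫⁻ u, s ^ blockLen P τ u ∂pastLaw) ^ k := by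
  induction k with
  | zero => simp
  | succ k ih =>
    have hmeas : Measurable[pastAlg] fun u =>
        s ^ (∑ i ∈ Finset.range k, blockLen P τ ((nextBlock P τ)^[i] u)) := by
      have : Measurable[pastAlg] fun u =>
          ∑ i ∈ Finset.range k, blockLen P τ ((nextBlock P τ)^[i] u) :=
        Finset.measurable_sum _ fun i _ => measurable_blockLen.comp
          (measurable_nextBlock.iterate i)
      exact (measurable_from_top (f := fun n : ℕ => s ^ n)).comp this
    have h := hgood.lintegral_blockLen_mul (fun n => s ^ n) hmeas
    rw [pow_succ', ← ih, ← h]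
    refine lintegral_congr fun u => ?_
    rw [Finset.sum_range_succ', pow_add, mul_comm]
    rfl

end Blocks

/-! ### Tails and exponential decay -/

section Tails

lemma tsum_natCast_le (z : ℝ≥0∞) : ∑' n : ℕ, (if (n : ℝ≥0∞) ≤ z then 1 else 0 : ℝ≥0∞) ≤ z + 1 := by
  rcases eq_or_ne z ⊤ with rfl | hz
  · simp
  lift z to NNReal using hz
  have hz : ∀ n ∉ Finset.range (⌊z⌋₊ + 1), (if (n : ℝ≥0∞) ≤ z then 1 else 0 : ℝ≥0∞) = 0 := by
    intro n hn
    rw [if_neg]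
    intro hle
    refine hn (Finset.mem_range.2 (Nat.lt_succ_of_le (Nat.le_floor ?_)))
    exact_mod_cast hle
  rw [tsum_eq_sum hz]
  calc ∑ n ∈ Finset.range (⌊z⌋₊ + 1), (if (n : ℝ≥0∞) ≤ z then 1 else 0 : ℝ≥0∞)
      ≤ ∑ n ∈ Finset.range (⌊z⌋₊ + 1), 1 := Finset.sum_le_sum fun n _ => by split_ifs <;> simp
    _ = (⌊z⌋₊ : ℝ≥0∞) + 1 := by simp
    _ ≤ z + 1 := by
        gcongr
        exact_mod_cast Nat.floor_le (zero_le : 0 ≤ z)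

lemma tsum_measure_natCast_le {Ω : Type*} {mΩ : MeasurableSpace Ω} (μ : Measure Ω)
    [IsProbabilityMeasure μ] {Z : Ω → ℝ≥0∞} (hZ : Measurable Z) :
    ∑' n : ℕ, μ {u | (n : ℝ≥0∞) ≤ Z u} ≤ ∫⁻ u, Z u ∂μ + 1 := by
  have hm : ∀ n : ℕ, MeasurableSet {u | (n : ℝ≥0∞) ≤ Z u} := fun n => hZ measurableSet_Ici
  calc ∑' n : ℕ, μ {u | (n : ℝ≥0∞) ≤ Z u}
      = ∑' n : ℕ, ∫⁻ u, {u | (n : ℝ≥0∞) ≤ Z u}.indicator 1 u ∂μ := by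
        simp_rw [lintegral_indicator_one (hm _)]
    _ = ∫⁻ u, ∑' n : ℕ, {u | (n : ℝ≥0∞) ≤ Z u}.indicator 1 u ∂μ :=
        (lintegral_tsum fun n => (measurable_one.indicator (hm n)).aemeasurable).symm
    _ ≤ ∫⁻ u, (Z u + 1) ∂μ := lintegral_mono fun u => by
        simpa [Set.indicator_apply] using tsum_natCast_le (Z u)
    _ = _ := by rw [lintegral_add_right _ measurable_const]; simp

lemma ExpDecay.mono {c c' : ℕ → ℝ} (hc : ExpDecay c) (h : ∀ n, c' n ≤ c n) : ExpDecay c' := by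
  obtain ⟨D, d, hD, hd0, hd1, hcd⟩ := hc
  exact ⟨D, d, hD, hd0, hd1, fun n => (h n).trans (hcd n)⟩

lemma ExpDecay.add {c c' : ℕ → ℝ} (hc : ExpDecay c) (hc' : ExpDecay c') :
    ExpDecay fun n => c n + c' n := by
  obtain ⟨D, d, hD, hd0, hd1, hcd⟩ := hc
  obtain ⟨D', d', hD', hd0', hd1', hcd'⟩ := hc'
  refine ⟨D + D', max d d', by positivity, lt_max_of_lt_left hd0, max_lt hd1 hd1', fun n => ?_⟩
  rw [add_mul]
  refine add_le_add ((hcd n).trans ?_) ((hcd' n).trans ?_)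
  · exact mul_le_mul_of_nonneg_left (pow_le_pow_left₀ hd0.le (le_max_left _ _) n) hD.le
  · exact mul_le_mul_of_nonneg_left (pow_le_pow_left₀ hd0'.le (le_max_right _ _) n) hD'.le

lemma ExpDecay.of_le_of_ge {c c' : ℕ → ℝ} (hc : ExpDecay c) (M : ℕ) (h1 : ∀ n, c' n ≤ 1)
    (h : ∀ n ≥ M, c' n ≤ c n) : ExpDecay c' := by
  obtain ⟨D, d, hD, hd0, hd1, hcd⟩ := hc
  refine ⟨D + (d ^ M)⁻¹, d, by positivity, hd0, hd1, fun n => ?_⟩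
  have hdn : 0 ≤ d ^ n := by positivity
  have hdM : 0 < d ^ M := by positivity
  rcases le_total M n with hn | hn
  · have : 0 ≤ (d ^ M)⁻¹ * d ^ n := by positivity
    linarith [h n hn, hcd n]
  · have h2 : 1 ≤ (d ^ M)⁻¹ * d ^ n := by
      rw [inv_mul_eq_div, le_div_iff₀ hdM, one_mul]
      exact pow_le_pow_of_le_one hd0.le hd1.le hn
    have : 0 ≤ D * d ^ n := by positivity
    linarith [h1 n]

lemma ExpDecay.comp_div {c : ℕ → ℝ} (hc : ExpDecay c) {p : ℕ} (hp : p ≠ 0) :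
    ExpDecay fun n => c (n / p) := by
  obtain ⟨D, d, hD, hd0, hd1, hcd⟩ := hc
  set e : ℝ := d ^ ((p : ℝ)⁻¹) with he
  have he0 : 0 < e := Real.rpow_pos_of_pos hd0 _
  have he1 : e < 1 := Real.rpow_lt_one hd0.le hd1 (by positivity)
  have hep : e ^ p = d := Real.rpow_inv_natCast_pow hd0.le hp
  refine ⟨D * d⁻¹, e, by positivity, he0, he1, fun n => (hcd _).trans ?_⟩
  rw [mul_assoc]
  refine mul_le_mul_of_nonneg_left ?_ hD.le
  rw [inv_mul_eq_div, le_div_iff₀ hd0, ← pow_succ]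
  conv_lhs => rw [← hep, ← pow_mul]
  refine pow_le_pow_of_le_one he0.le he1.le ?_
  have := Nat.div_add_mod n p
  have := Nat.mod_lt n (Nat.pos_of_ne_zero hp)
  rw [mul_add]
  omega

end Tails

/-! ### The reach of a block -/

section Reach

variable {A : Type*} [Fintype A] [LinearOrder A] {P : TransitionKernel A} {τ : ContextTree A}
  {h : List A → ℕ}

lemma measurableSet_succ_le_maxCtx (k : ℕ) :
    MeasurableSet[timesAlg (Set.Ioc (-k : ℤ) 0)]
      {u : ℤ → UnitIco | ((k + 1 : ℕ) : ℕ∞) ≤ maxCtx P τ u 0} := by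
  have h1 := measurableSet_of_letters (P := P) (Finset.Ioc (-k : ℤ) 0)
    (G := {u | maxCtx P τ u 0 ≤ k}) fun u hu u' hu' =>
      (maxCtx_congr hu fun i hi => hu' _ (Finset.mem_Ioc.2 ⟨by omega, by omega⟩)).trans_le hu
  rw [Finset.coe_Ioc] at h1
  convert h1.compl using 1
  ext u
  simp only [Set.mem_ofPred_eq, Set.mem_compl_iff, not_le, Nat.cast_add, Nat.cast_one]
  exact ENat.add_one_le_iff (ENat.natCast_ne_top k)

lemma measurableSet_natCast_le_absGood (j : ℕ) :
    MeasurableSet[timesAlg (Set.Ioc (-j : ℤ) 0)] {u | (j : ℕ∞) ≤ absGood P τ u} := by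
  have h1 := measurableSet_of_letters (P := P) (Finset.Ioc (-j : ℤ) 0)
    (G := {u | absGood P τ u < j}) fun u hu u' hu' => by
      obtain ⟨l, hl⟩ := ENat.ne_top_iff_exists.1 (ne_top_of_lt hu)
      have hlj : l < j := by
        rw [Set.mem_ofPred_eq, ← hl] at hu
        exact_mod_cast hu
      have := absGood_congr (u' := u')
        (fun i hi => hu' _ (Finset.mem_Ioc.2 ⟨by omega, by omega⟩)) hl.symm
      rw [Set.mem_ofPred_eq, this]
      exact_mod_cast hlj
  rw [Finset.coe_Ioc] at h1
  convert h1.compl using 1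
  ext u
  simp

lemma measure_star (k : ℕ) : unifSeq {u | letterOf P (u (-k)) = none} =
    unifSeq {u | letterOf P (u 0) = none} :=
  (unifSeq_eval _ (measurableSet_letterOf_eq none)).trans
    (unifSeq_eval _ (measurableSet_letterOf_eq none)).symm

lemma measurableSet_star (i : ℤ) :
    MeasurableSet[timesAlg {i}] {u : ℤ → UnitIco | letterOf P (u i) = none} :=
  measurable_eval_timesAlg (Set.mem_singleton i) (measurableSet_letterOf_eq none)

lemma measure_star_inter_shift {D : Set (ℤ → UnitIco)} (hD : MeasurableSet[pastAlg] D) :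
    unifSeq ({u | letterOf P (u 0) = none} ∩ shift 1 ⁻¹' D) =
      unifSeq {u | letterOf P (u 0) = none} * unifSeq D := by
  rw [measure_inter_of_disjoint_times (I := {0}) (J := Set.Iic (-1)) (by simp)
    (measurableSet_star 0) (measurable_shift_timesAlg (fun j hj => ?_) hD),
    (measurePreserving_shift 1).measure_preimage (timesAlg_le _ _ hD).nullMeasurableSet]
  simp only [Set.mem_Iic] at hj ⊢
  omega

/-- In a skeleton, the probability of a star at time `0` before which the contexts may have length
`k + 1` is at most the probability that contexts may be longer than `k + 1`: by independence and
stationarity the star may be moved to the oldest position of a context of length `k + 1`, where it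
can be filled so as to prolong the context. -/
lemma measure_star_inter_le (hτ : τ.IsSkeleton) (k : ℕ) :
    unifSeq ({u | letterOf P (u 0) = none} ∩
      shift 1 ⁻¹' {u | ((k + 1 : ℕ) : ℕ∞) ≤ maxCtx P τ u 0}) ≤
      unifSeq {u | ((k + 1 : ℕ) : ℕ∞) < maxCtx P τ u 0} := by
  rw [measure_star_inter_shift
    (timesAlg_mono Set.Ioc_subset_Iic_self _ (measurableSet_succ_le_maxCtx k)),
    ← measure_star k, mul_comm, ← measure_inter_of_disjoint_times (by simp)
    (measurableSet_succ_le_maxCtx k) (measurableSet_star _)]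
  exact measure_mono fun u hu => lt_maxCtx_of_star hτ hu.1 hu.2

lemma hInv_le {A : Type*} {τ : ContextTree A} {h : List A → ℕ} {v : List A}
    (hv : Str.fin v ∈ τ.carrier) (hne : v ≠ []) {m : ℕ} (hm : m < h v) :
    hInv τ h m ≤ v.length := by
  refine iInf₂_le v.length ⟨List.length_pos_iff.2 hne, lt_of_lt_of_le (b := (h v : ℕ∞)) ?_ ?_⟩
  · exact_mod_cast hm
  · exact le_iSup₂_of_le (f := fun w (_ : w ∈ {w : List A | Str.fin w ∈ τ.carrier ∧
      w.length ≤ v.length}) => (h w : ℕ∞)) v ⟨hv, le_rfl⟩ le_rfl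

lemma one_le_hInv {A : Type*} (τ : ContextTree A) (h : List A → ℕ) (m : ℕ) : 1 ≤ hInv τ h m :=
  le_iInf₂ fun k hk => by exact_mod_cast hk.1

/-- The probability of a reach larger than `m` is at most the expected number of stars of the block
with a possible context whose continuity radius is larger than `m`. The event that the block
contains time `-j` is independent of the driving variables up to time `-j`, so that this expectation
factorises as in Wald's identity. The empty context is excluded because it has length `0`, while
`h⁻¹` only considers lengths `k ≥ 1`. -/
lemma IsGood.measure_compl_reachLE_le (hgood : IsGood P τ) (hτ : τ.IsSkeleton) {m : ℕ}
    (hm : h [] ≤ m) :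
    unifSeq (reachLE P τ h m)ᶜ ≤
      (meanGood P τ + 1) * unifSeq {u | hInv τ h m < maxCtx P τ u 0} := by
  rcases eq_or_ne (hInv τ h m) ⊤ with htop | htop
  · have : unifSeq (reachLE P τ h m)ᶜ = 0 := by
      rw [← hgood.measure_inter]
      convert measure_empty (μ := unifSeq)
      refine Set.eq_empty_of_forall_notMem fun u hu => hu.2 ⟨hu.1, fun j hj hs v hv hl => ?_⟩
      by_contra! hlt
      have := hInv_le hv (fun hnil => by rw [hnil] at hlt; omega) hlt
      simp [htop] at this
    simp [this]
  obtain ⟨K, hK⟩ := ENat.ne_top_iff_exists.1 htop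
  have h1 : 1 ≤ K := by
    have := one_le_hInv τ h m
    rw [← hK] at this
    exact_mod_cast this
  obtain ⟨k, rfl⟩ := Nat.exists_eq_add_of_le' h1
  set D : Set (ℤ → UnitIco) := {u | letterOf P (u 0) = none} ∩
    shift 1 ⁻¹' {u | ((k + 1 : ℕ) : ℕ∞) ≤ maxCtx P τ u 0} with hD
  have hDm : MeasurableSet[pastAlg] D := by
    refine MeasurableSet.inter (timesAlg_mono (by simp) _ (measurableSet_star 0)) ?_
    refine measurable_shift_timesAlg (J := Set.Iic 0) (fun j hj => ?_)
      (timesAlg_mono Set.Ioc_subset_Iic_self _ (measurableSet_succ_le_maxCtx k))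
    simp only [Set.mem_Iic] at hj ⊢
    omega
  have hsub : {u | absGood P τ u < ⊤} ∩ (reachLE P τ h m)ᶜ ⊆
      ⋃ j : ℕ, {u | (j : ℕ∞) ≤ absGood P τ u} ∩ shift j ⁻¹' D := by
    rintro u ⟨hu, hnot⟩
    have hnot : ¬ _ := hnot
    simp only [reachLE, Set.mem_ofPred_eq, not_and, not_forall, not_le] at hnot
    obtain ⟨j, hj, hs, v, hv, hl, hlt⟩ := hnot hu
    refine Set.mem_iUnion.2 ⟨j, hj, ?_, ?_⟩
    · simpa [shift] using hs
    · have h2 := hInv_le hv (fun hnil => by rw [hnil] at hlt; omega) hlt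
      rw [← hK] at h2
      simp only [Set.mem_preimage, Set.mem_ofPred_eq, maxCtx_shift]
      rw [show (0 : ℤ) - 1 - j = -j - 1 by ring]
      exact h2.trans hl
  rw [← hgood.measure_inter, ← hK]
  calc unifSeq ({u | absGood P τ u < ⊤} ∩ (reachLE P τ h m)ᶜ)
      ≤ ∑' j : ℕ, unifSeq ({u | (j : ℕ∞) ≤ absGood P τ u} ∩ shift j ⁻¹' D) :=
        (measure_mono hsub).trans (measure_iUnion_le _)
    _ = ∑' j : ℕ, unifSeq {u | (j : ℕ∞) ≤ absGood P τ u} * unifSeq D := by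
        refine tsum_congr fun j => ?_
        rw [measure_inter_of_disjoint_times (J := Set.Iic (-j : ℤ)) ?_
          (measurableSet_natCast_le_absGood j) (measurable_shift_timesAlg (fun i hi => ?_) hDm),
          (measurePreserving_shift _).measure_preimage (timesAlg_le _ _ hDm).nullMeasurableSet]
        · exact Set.disjoint_left.2 fun i hi hi' => absurd hi.1 (not_lt.2 hi')
        · simp only [Set.mem_Iic] at hi ⊢
          omega
    _ ≤ _ := by
        rw [ENNReal.tsum_mul_right]
        refine mul_le_mul' ?_ (measure_star_inter_le hτ k)
        have := tsum_measure_natCast_le unifSeq (measurable_coe_absGood (P := P) (τ := τ))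
        refine le_trans (le_of_eq ?_) this
        refine tsum_congr fun n => congrArg _ (Set.ext fun u => ?_)
        simp only [Set.mem_ofPred_eq]
        exact_mod_cast Iff.rfl

/-- If a letter is read off at time `0`, the block is the single time `0` and does not involve its
past. -/
lemma letter_subset_reachLE (m : ℕ) :
    {u : ℤ → UnitIco | letterOf P (u 0) = none}ᶜ ⊆ reachLE P τ h m := by
  intro u hu
  have h0 : absGood P τ u = 0 := absGood_eq_zero hu
  refine ⟨by simp [h0], fun j hj hs => ?_⟩
  rw [h0] at hj
  obtain rfl : j = 0 := by simpa using hj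
  exact absurd (by simpa using hs) hu

lemma one_sub_measure_star_le_reachLE (m : ℕ) :
    1 - unifSeq {u | letterOf P (u 0) = none} ≤ pastLaw (reachLE P τ h m) := by
  rw [pastLaw_apply (isBlockEvent_reachLE m).measurableSet,
    ← prob_compl_eq_one_sub (timesAlg_le _ _ (measurableSet_star 0))]
  exact measure_mono (letter_subset_reachLE m)

lemma alphaMinusOne_le_reachLE [Nonempty A] (m : ℕ) :
    alphaMinusOne P ≤ pastLaw.real (reachLE P τ h m) := by
  have hα0 : 0 ≤ alphaMinusOne P := Finset.sum_nonneg fun j _ => alphaLetter_nonneg j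
  rw [Measure.real, ← ENNReal.ofReal_le_iff_le_toReal (measure_ne_top _ _)]
  refine le_trans (le_of_eq ?_) (one_sub_measure_star_le_reachLE m)
  rw [← prob_compl_eq_one_sub (timesAlg_le _ _ (measurableSet_star 0))]
  refine Eq.trans ?_ (unifSeq_eval 0 ((measurableSet_letterOf_eq (P := P) none).compl)).symm
  rw [← sub_zero (alphaMinusOne P), ← unif_Ico le_rfl alphaMinusOne_le_one]
  congr 1
  ext s
  simp [letterOf_eq_none_iff, s.2.1]

lemma IsGood.slcSeq_le_reachLE (hgood : IsGood P τ) (hτ : τ.IsSkeleton) {m : ℕ} (hm0 : m ≠ 0)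
    (hm : h [] ≤ m) : slcSeq P τ h m ≤ pastLaw.real (reachLE P τ h m) := by
  have hmeas := (isBlockEvent_reachLE (P := P) (τ := τ) (h := h) m).measurableSet
  have h1 := ENNReal.toReal_mono (ENNReal.mul_ne_top (ENNReal.add_ne_top.2
    ⟨ne_of_lt hgood, ENNReal.one_ne_top⟩) (measure_ne_top _ _))
    (hgood.measure_compl_reachLE_le hτ hm)
  rw [ENNReal.toReal_mul, ENNReal.toReal_add (ne_of_lt hgood) ENNReal.one_ne_top,
    prob_compl_eq_one_sub (timesAlg_le _ _ hmeas), ENNReal.toReal_sub_of_le prob_le_one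
    ENNReal.one_ne_top] at h1
  rw [slcSeq, if_neg hm0, Measure.real, pastLaw_apply hmeas]
  simp only [ENNReal.toReal_one] at h1
  linarith

lemma hSup_lt_top {A : Type*} [Fintype A] (τ : ContextTree A) (h : List A → ℕ) (k : ℕ) :
    hSup τ h k < ⊤ := by
  have hfin : {v : List A | Str.fin v ∈ τ.carrier ∧ v.length ≤ k}.Finite :=
    (List.finite_length_le A k).subset fun v hv => hv.2
  obtain ⟨M, hM⟩ := (hfin.image h).bddAbove
  refine lt_of_le_of_lt (iSup₂_le fun v hv => ?_) (ENat.natCast_lt_top M)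
  exact_mod_cast hM ⟨v, hv, rfl⟩

lemma hSup_mono {A : Type*} (τ : ContextTree A) (h : List A → ℕ) : Monotone (hSup τ h) :=
  fun _ _ hij => biSup_mono fun _ hv => ⟨hv.1, hv.2.trans hij⟩

/-- If stars have positive probability, the maximal context length given the letters is almost
surely finite, because `θ̄[0]` is almost surely finite; hence `A_m` tends to `1`. -/
lemma IsGood.eventually_slcSeq_pos (hgood : IsGood P τ)
    (hstar : unifSeq {u | letterOf P (u 0) = none} ≠ 0) :
    ∀ᶠ m in atTop, 0 < slcSeq P τ h m := by
  have hmeas : ∀ k : ℕ, MeasurableSet[pastAlg] {u | (k : ℕ∞) < maxCtx P τ u 0} := fun k => by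
    have := timesAlg_mono Set.Ioc_subset_Iic_self _
      (measurableSet_succ_le_maxCtx (P := P) (τ := τ) k)
    convert this using 3 with u
    push_cast
    exact (ENat.add_one_le_iff (ENat.natCast_ne_top k)).symm
  have htop : (⋂ k : ℕ, {u | (k : ℕ∞) < maxCtx P τ u 0}) = {u | maxCtx P τ u 0 = ⊤} := by
    ext u
    simp only [Set.mem_iInter, Set.mem_ofPred_eq]
    exact ⟨ENat.eq_top_iff_forall_gt.2, fun hu k => hu ▸ ENat.natCast_lt_top k⟩
  have hnull : unifSeq {u | maxCtx P τ u 0 = ⊤} = 0 := by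
    have hm : MeasurableSet[pastAlg] {u | maxCtx P τ u 0 = ⊤} :=
      htop ▸ MeasurableSet.iInter hmeas
    have h1 := measure_star_inter_shift (P := P) hm
    rw [← hgood.measure_inter, show {u | absGood P τ u < ⊤} ∩ ({u | letterOf P (u 0) = none} ∩
      shift 1 ⁻¹' {u | maxCtx P τ u 0 = ⊤}) = ∅ from ?_, measure_empty] at h1
    · exact (mul_eq_zero.1 h1.symm).resolve_left hstar
    · refine Set.eq_empty_of_forall_notMem fun u hu => ?_
      obtain ⟨l, hl⟩ := ENat.ne_top_iff_exists.1 (ne_of_lt hu.1)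
      have h2 := maxCtx_le_of_star (j := 0) hl.symm (Nat.zero_le l) (by simpa using hu.2.1)
      have h3 : maxCtx P τ (shift 1 u) 0 = ⊤ := hu.2.2
      rw [maxCtx_shift] at h3
      simp only [Nat.cast_zero, neg_zero] at h2
      rw [h3] at h2
      simp at h2
  have hlim : Tendsto (fun k : ℕ => unifSeq.real {u | (k : ℕ∞) < maxCtx P τ u 0}) atTop (𝓝 0) := by
    have hanti : Antitone fun k : ℕ => {u | (k : ℕ∞) < maxCtx P τ u 0} := fun i j hij u hu => by
      rw [Set.mem_ofPred_eq] at hu ⊢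
      exact lt_of_le_of_lt (Nat.cast_le.2 hij) hu
    have := tendsto_measure_iInter_atTop (μ := unifSeq)
      (fun k : ℕ => (timesAlg_le _ _ (hmeas k)).nullMeasurableSet)
      hanti ⟨0, measure_ne_top _ _⟩
    rw [htop, hnull] at this
    exact (ENNReal.tendsto_toReal ENNReal.zero_ne_top).comp this
  have hlim' := hlim.const_mul ((meanGood P τ).toReal + 1)
  rw [mul_zero] at hlim'
  obtain ⟨k, hk⟩ := (hlim'.eventually (gt_mem_nhds one_pos)).exists
  obtain ⟨M, hM⟩ := ENat.ne_top_iff_exists.1 (hSup_lt_top τ h k).ne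
  filter_upwards [eventually_ge_atTop M, eventually_ne_atTop 0] with m hm hm0
  have hkm : (k : ℕ∞) ≤ hInv τ h m := le_iInf₂ fun i hi => by
    by_contra! hlt
    have h1 : i ≤ k := by exact_mod_cast hlt.le
    have h2 := hi.2.trans_le (hSup_mono τ h h1)
    rw [← hM] at h2
    norm_cast at h2
    omega
  have hle : unifSeq.real {u | hInv τ h m < maxCtx P τ u 0} ≤
      unifSeq.real {u | (k : ℕ∞) < maxCtx P τ u 0} :=
    measureReal_mono fun u hu => hkm.trans_lt hu
  have hpos : (0 : ℝ) ≤ (meanGood P τ).toReal + 1 := by positivity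
  have h3 := mul_le_mul_of_nonneg_left hle hpos
  rw [slcSeq, if_neg hm0]
  simp only [Measure.real] at h3 hk
  linarith

end Reach

/-! ### Tails of the coalescence time -/

section CoalescenceTail

variable {A : Type*} [Fintype A] [LinearOrder A] {P : TransitionKernel A} {τ : ContextTree A}
  {h : List A → ℕ}

/-- The event that, for each `k = 1, …, n`, one of the first `k` blocks reaches beyond these `k`
blocks. -/
abbrev noBlockRenewal (P : TransitionKernel A) (τ : ContextTree A) (h : List A → ℕ) (n : ℕ) :
    Set (ℤ → UnitIco) :=
  noRenewal (nextBlock P τ) (reachLE P τ h) n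

/-- The number of times in the first `k` blocks. -/
noncomputable abbrev totalLen (P : TransitionKernel A) (τ : ContextTree A) (k : ℕ)
    (u : ℤ → UnitIco) : ℕ :=
  ∑ i ∈ Finset.range k, blockLen P τ ((nextBlock P τ)^[i] u)

lemma measurableSet_noBlockRenewal (n : ℕ) : MeasurableSet[pastAlg] (noBlockRenewal P τ h n) :=
  measurableSet_noRenewal measurable_nextBlock
    (fun m => (isBlockEvent_reachLE m).measurableSet) n

lemma measurable_totalLen (k : ℕ) : Measurable[pastAlg] (totalLen P τ k) :=
  Finset.measurable_sum _ fun i _ => measurable_blockLen.comp (measurable_nextBlock.iterate i)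

lemma pastLaw_reachLE_inter (m : ℕ) (D : Set (ℤ → UnitIco)) (hD : MeasurableSet[pastAlg] D) :
    pastLaw (reachLE P τ h m ∩ nextBlock P τ ⁻¹' D) = pastLaw (reachLE P τ h m) * pastLaw D := by
  have hm := isBlockEvent_reachLE (P := P) (τ := τ) (h := h) m
  rw [pastLaw_apply (hm.measurableSet.inter (measurable_nextBlock hD)),
    pastLaw_apply hm.measurableSet, pastLaw_apply hD, hm.measure_inter hD]

lemma exists_renewal_of_notMem {u : ℤ → UnitIco} {n : ℕ} (hu : u ∉ noBlockRenewal P τ h n) :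
    ∃ k, 1 ≤ k ∧ k ≤ n ∧ u ∈ renewalAt (nextBlock P τ) (reachLE P τ h) k := by
  simpa [noBlockRenewal, noRenewal] using hu

lemma absCoal_lt_totalLen (hP : IsSLCWith P τ h) {u : ℤ → UnitIco} {n : ℕ}
    (hu : u ∉ noBlockRenewal P τ h n) : absCoal (update P) u < (totalLen P τ n u : ℕ∞) := by
  obtain ⟨k, hk1, hkn, hk⟩ := exists_renewal_of_notMem hu
  refine (absCoal_lt_of_renewalAt hP (by omega) hk).trans_le ?_
  exact_mod_cast Finset.sum_le_sum_of_subset (Finset.range_mono hkn)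

lemma isFeasible_of_ae {A : Type*} {F : (ℕ → A) → UnitIco → A}
    (hF : ∀ᵐ u ∂unifSeq, absCoal F u < ⊤) : IsFeasible F := by
  intro m n _
  have : ∀ᵐ u ∂unifSeq, ∀ k : ℤ, absCoal F (shift k u) < ⊤ :=
    ae_all_iff.2 fun k => (measurePreserving_shift k).quasiMeasurePreserving.ae hF
  filter_upwards [this] with u hu
  exact coalTimes_nonempty hu m n

/-- The tail of the number of blocks needed to coalesce. -/
noncomputable abbrev blockTail (P : TransitionKernel A) (τ : ContextTree A) (h : List A → ℕ)
    (n : ℕ) : ℝ :=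
  pastLaw.real (noBlockRenewal P τ h n)

lemma ae_absCoal_lt_top (hP : IsSLCWith P τ h)
    (hr : Tendsto (blockTail P τ h) atTop (𝓝 0)) :
    ∀ᵐ u ∂unifSeq, absCoal (update P) u < ⊤ := by
  refine measure_mono_null (t := ⋂ n, noBlockRenewal P τ h n) ?_ ?_
  · intro u hu
    refine Set.mem_iInter.2 fun n => ?_
    by_contra hn
    exact hu ((absCoal_lt_totalLen hP hn).trans_le le_top)
  · refine le_antisymm (ge_of_tendsto' (x := atTop)
      (f := fun n => ENNReal.ofReal (blockTail P τ h n)) ?_ fun n => ?_) (zero_le)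
    · simpa using ENNReal.tendsto_ofReal hr
    · rw [blockTail, ofReal_measureReal, pastLaw_apply (measurableSet_noBlockRenewal n)]
      exact measure_mono (Set.iInter_subset _ n)

lemma IsGood.sum_blockTail (hgood : IsGood P τ) (n : ℕ) :
    ∑ k ∈ Finset.range (n + 1), (∏ j ∈ Finset.range k, pastLaw.real (reachLE P τ h j)) *
      blockTail P τ h (n - k) = 1 :=
  sum_real_last_renewal hgood.measurePreserving_nextBlock
    (fun m => (isBlockEvent_reachLE m).measurableSet) (fun _ _ => reachLE_mono)
    pastLaw_reachLE_inter n

lemma blockTail_antitone : Antitone (blockTail P τ h) :=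
  fun _ _ hmn => measureReal_mono (noRenewal_antitone hmn)

lemma IsGood.lintegral_blockLen_lt_top (hgood : IsGood P τ) :
    ∫⁻ u, (blockLen P τ u : ℝ≥0∞) ∂pastLaw < ⊤ := by
  have hm : Measurable[pastAlg] fun u => (blockLen P τ u : ℝ≥0∞) :=
    (measurable_from_top (f := fun n : ℕ => (n : ℝ≥0∞))).comp measurable_blockLen
  rw [pastLaw, lintegral_trim _ hm]
  calc ∫⁻ u, (blockLen P τ u : ℝ≥0∞) ∂unifSeq
      ≤ ∫⁻ u, ((absGood P τ u : ℝ≥0∞) + 1) ∂unifSeq := by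
        refine lintegral_mono fun u => ?_
        cases hu : absGood P τ u with
        | top => simp
        | coe l => simp [blockLen, hu]
    _ = meanGood P τ + 1 := by rw [lintegral_add_right _ measurable_const]; simp [meanGood]
    _ < ⊤ := ENNReal.add_lt_top.2 ⟨hgood, ENNReal.one_lt_top⟩

/-- The coalescence time is bounded by the total length of the blocks needed to
coalesce, which has a finite mean, by Wald's identity, if the number of blocks does. -/
lemma IsGood.summableTail (hgood : IsGood P τ) (hP : IsSLCWith P τ h)
    (hr : Summable (blockTail P τ h)) : SummableTail (absCoal (update P)) := by
  set Z : (ℤ → UnitIco) → ℝ≥0∞ := fun u => ∑' k : ℕ, (noBlockRenewal P τ h k).indicator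
    (fun u => (blockLen P τ ((nextBlock P τ)^[k] u) : ℝ≥0∞)) u with hZ
  have hlen : ∀ k, Measurable[pastAlg] fun u =>
      (blockLen P τ ((nextBlock P τ)^[k] u) : ℝ≥0∞) := fun k =>
    (measurable_from_top (f := fun n : ℕ => (n : ℝ≥0∞))).comp
      (measurable_blockLen.comp (measurable_nextBlock.iterate k))
  have hterm : ∀ k, Measurable[pastAlg] ((noBlockRenewal P τ h k).indicator
      (fun u => (blockLen P τ ((nextBlock P τ)^[k] u) : ℝ≥0∞))) := fun k =>
    (hlen k).indicator (measurableSet_noBlockRenewal k)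
  have hZm : Measurable[pastAlg] Z := by
    simp_rw [hZ, ENNReal.tsum_eq_iSup_sum]
    exact .iSup fun s => s.measurable_fun_sum fun i _ => hterm i
  have hWZ : ∀ u, (absCoal (update P) u : ℝ≥0∞) ≤ Z u := by
    intro u
    by_cases hu : ∃ k, u ∉ noBlockRenewal P τ h k
    · classical
      have hlt := absCoal_lt_totalLen hP (Nat.find_spec hu)
      calc (absCoal (update P) u : ℝ≥0∞)
          ≤ ((totalLen P τ (Nat.find hu) u : ℕ) : ℝ≥0∞) := by
            rw [← ENat.toENNReal_coe]
            exact ENat.toENNReal_le.2 hlt.le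
        _ = ∑ k ∈ Finset.range (Nat.find hu), (noBlockRenewal P τ h k).indicator
              (fun u => (blockLen P τ ((nextBlock P τ)^[k] u) : ℝ≥0∞)) u := by
            rw [totalLen, Nat.cast_sum]
            refine Finset.sum_congr rfl fun k hk => ?_
            rw [Set.indicator_of_mem (not_not.1 (Nat.find_min hu (Finset.mem_range.1 hk)))]
        _ ≤ Z u := ENNReal.sum_le_tsum _
    · push Not at hu
      have : Z u = ⊤ := by
        refine top_le_iff.1 ((ENNReal.tsum_const_eq_top_of_ne_zero (α := ℕ) one_ne_zero).ge.trans
          (ENNReal.tsum_le_tsum fun k => ?_))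
        rw [Set.indicator_of_mem (hu k)]
        exact_mod_cast Nat.succ_le_succ (Nat.zero_le _)
      rw [this]
      exact le_top
  have hint : ∫⁻ u, Z u ∂pastLaw < ⊤ := by
    rw [hZ, lintegral_tsum fun k => (hterm k).aemeasurable]
    have hk : ∀ k, ∫⁻ u, (noBlockRenewal P τ h k).indicator
        (fun u => (blockLen P τ ((nextBlock P τ)^[k] u) : ℝ≥0∞)) u ∂pastLaw =
        pastLaw (noBlockRenewal P τ h k) * ∫⁻ u, (blockLen P τ u : ℝ≥0∞) ∂pastLaw := fun k => by
      rw [lintegral_indicator (measurableSet_noBlockRenewal k)]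
      exact setLIntegral_noRenewal hgood.measurePreserving_nextBlock
        (fun m => (isBlockEvent_reachLE m).measurableSet) (fun _ _ => reachLE_mono)
        pastLaw_reachLE_inter k (hlen 0)
    simp_rw [hk]
    rw [ENNReal.tsum_mul_right]
    refine ENNReal.mul_lt_top ?_ hgood.lintegral_blockLen_lt_top
    have := hr.tsum_ofReal_lt_top
    refine lt_of_le_of_lt (le_of_eq (tsum_congr fun k => ?_)) this
    exact (ofReal_measureReal (μ := pastLaw)).symm
  calc ∑' n : ℕ, unifSeq {u | (n : ℕ∞) ≤ absCoal (update P) u}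
      ≤ ∑' n : ℕ, pastLaw {u | (n : ℝ≥0∞) ≤ Z u} := by
        refine ENNReal.tsum_le_tsum fun n => ?_
        have hm : MeasurableSet[pastAlg] {u | (n : ℝ≥0∞) ≤ Z u} := hZm measurableSet_Ici
        rw [pastLaw_apply hm]
        refine measure_mono fun u hu => le_trans ?_ (hWZ u)
        rw [← ENat.toENNReal_coe]
        exact ENat.toENNReal_le.2 hu
    _ ≤ ∫⁻ u, Z u ∂pastLaw + 1 := tsum_measure_natCast_le pastLaw hZm
    _ < ⊤ := ENNReal.add_lt_top.2 ⟨hint, ENNReal.one_lt_top⟩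

/-- An exponential tail of `θ̄[0]` provides an exponential moment of the block length. -/
lemma exists_lintegral_pow_blockLen_lt_top (hexp : ExpTail (absGood P τ)) :
    ∃ s : ℝ, 1 < s ∧ ∫⁻ u, ENNReal.ofReal s ^ blockLen P τ u ∂pastLaw < ⊤ := by
  obtain ⟨D, d, hD, hd0, hd1, hDd⟩ := hexp
  set s : ℝ := 2 / (1 + d) with hs
  have hs1 : 1 < s := by rw [hs, lt_div_iff₀ (by linarith)]; linarith
  have hsd : s * d < 1 := by rw [hs, div_mul_eq_mul_div, div_lt_one (by linarith)]; linarith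
  have hs0 : 0 < s := by linarith
  refine ⟨s, hs1, ?_⟩
  have hm : ∀ l : ℕ, MeasurableSet[pastAlg] {u | (l : ℕ∞) ≤ absGood P τ u} := fun l =>
    timesAlg_mono Set.Ioc_subset_Iic_self _ (measurableSet_natCast_le_absGood l)
  calc ∫⁻ u, ENNReal.ofReal s ^ blockLen P τ u ∂pastLaw
      ≤ ∫⁻ u, ∑' l : ℕ, {u | (l : ℕ∞) ≤ absGood P τ u}.indicator
          (fun _ => ENNReal.ofReal s ^ (l + 1)) u ∂pastLaw := by
        refine lintegral_mono fun u => ?_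
        refine le_trans (le_of_eq ?_) (ENNReal.le_tsum (absGood P τ u).toNat)
        have hmem : u ∈ {v | ((absGood P τ u).toNat : ℕ∞) ≤ absGood P τ v} :=
          ENat.natCast_toNat_le_self _
        rw [Set.indicator_of_mem hmem, blockLen]
    _ = ∑' l : ℕ, ENNReal.ofReal s ^ (l + 1) * pastLaw {u | (l : ℕ∞) ≤ absGood P τ u} := by
        rw [lintegral_tsum fun l => (measurable_const.indicator (hm l)).aemeasurable]
        refine tsum_congr fun l => ?_
        rw [lintegral_indicator_const (hm l)]
    _ ≤ ∑' l : ℕ, ENNReal.ofReal (s * D * (s * d) ^ l) := by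
        refine ENNReal.tsum_le_tsum fun l => ?_
        have h1 := hDd l
        rw [← ENNReal.ofReal_toReal (measure_ne_top pastLaw {u | (l : ℕ∞) ≤ absGood P τ u}),
          ← ENNReal.ofReal_pow hs0.le, ← ENNReal.ofReal_mul (by positivity), pastLaw_apply (hm l)]
        refine ENNReal.ofReal_le_ofReal ?_
        calc s ^ (l + 1) * (unifSeq {u | (l : ℕ∞) ≤ absGood P τ u}).toReal
            ≤ s ^ (l + 1) * (D * d ^ l) := mul_le_mul_of_nonneg_left h1 (by positivity)
          _ = _ := by rw [mul_pow]; ring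
    _ < ⊤ := ((summable_geometric_of_lt_one (by positivity) hsd).mul_left _).tsum_ofReal_lt_top

/-- Chernoff's bound for the total length of the first `k` blocks. -/
lemma IsGood.measureReal_le_totalLen (hgood : IsGood P τ) {s : ℝ} (hs : 1 < s)
    (hfin : ∫⁻ u, ENNReal.ofReal s ^ blockLen P τ u ∂pastLaw < ⊤) (n k : ℕ) :
    pastLaw.real {u | n ≤ totalLen P τ k u} ≤
      (∫⁻ u, ENNReal.ofReal s ^ blockLen P τ u ∂pastLaw).toReal ^ k / s ^ n := by
  have hs0 : 0 < s := by linarith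
  rw [le_div_iff₀ (by positivity), mul_comm]
  have hm : Measurable[pastAlg] fun u => ENNReal.ofReal s ^ totalLen P τ k u :=
    (measurable_from_top (f := fun n : ℕ => ENNReal.ofReal s ^ n)).comp (measurable_totalLen k)
  have h1 := mul_meas_ge_le_lintegral (μ := pastLaw) hm (ENNReal.ofReal s ^ n)
  rw [hgood.lintegral_pow_sum_blockLen] at h1
  have h2 : ENNReal.ofReal s ^ n * pastLaw {u | n ≤ totalLen P τ k u} ≤
      (∫⁻ u, ENNReal.ofReal s ^ blockLen P τ u ∂pastLaw) ^ k := by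
    refine le_trans (mul_le_mul_right (measure_mono fun u hu => ?_) _) h1
    rw [Set.mem_ofPred_eq] at hu ⊢
    exact pow_le_pow_right₀ (by simpa using hs.le) hu
  have h3 := ENNReal.toReal_mono (ENNReal.pow_ne_top hfin.ne) h2
  rwa [ENNReal.toReal_mul, ENNReal.toReal_pow, ENNReal.toReal_pow, ENNReal.toReal_ofReal hs0.le]
    at h3

/-- Either the number of blocks needed to coalesce exceeds a small multiple of `n`, or that many
blocks have total length at least `n`. -/
lemma IsGood.expTail (hgood : IsGood P τ) (hP : IsSLCWith P τ h)
    (hexp : ExpTail (absGood P τ)) (hr : ExpDecay (blockTail P τ h)) :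
    ExpTail (absCoal (update P)) := by
  obtain ⟨s, hs, hfin⟩ := exists_lintegral_pow_blockLen_lt_top hexp
  have hs0 : 0 < s := by linarith
  set K := (∫⁻ u, ENNReal.ofReal s ^ blockLen P τ u ∂pastLaw).toReal with hK
  have hK0 : 0 ≤ K := ENNReal.toReal_nonneg
  obtain ⟨q, hq⟩ := pow_unbounded_of_one_lt K hs
  have hgeom : ExpDecay fun n => s⁻¹ ^ n :=
    ⟨1, s⁻¹, one_pos, by positivity, inv_lt_one_of_one_lt₀ hs, fun n => by rw [one_mul]⟩
  -- With `n / (2 (q + 1))` blocks the moments contribute at most `s ^ (n / 2)`.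
  refine ((hr.comp_div (p := 2 * (q + 1)) (by omega)).add
    (hgeom.comp_div (p := 2) (by omega))).mono fun n => ?_
  set k := n / (2 * (q + 1)) with hk
  have hkn : q * k ≤ n / 2 := by
    rw [Nat.le_div_iff_mul_le two_pos]
    calc q * k * 2 ≤ n / (2 * (q + 1)) * (2 * (q + 1)) := by rw [← hk]; nlinarith
      _ ≤ n := Nat.div_mul_le_self _ _
  have hsub : {u | (n : ℕ∞) ≤ absCoal (update P) u} ⊆
      noBlockRenewal P τ h k ∪ {u | n ≤ totalLen P τ k u} := by
    intro u hu
    by_contra hnot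
    rw [Set.mem_union, not_or] at hnot
    refine hnot.2 ?_
    have := lt_of_le_of_lt (show (n : ℕ∞) ≤ absCoal (update P) u from hu)
      (absCoal_lt_totalLen hP hnot.1)
    exact (show n < totalLen P τ k u by exact_mod_cast this).le
  have hm : MeasurableSet[pastAlg] {u | n ≤ totalLen P τ k u} :=
    measurable_totalLen k measurableSet_Ici
  have h1 : (unifSeq {u | (n : ℕ∞) ≤ absCoal (update P) u}).toReal ≤
      blockTail P τ h k + pastLaw.real {u | n ≤ totalLen P τ k u} := by
    refine le_trans (ENNReal.toReal_mono (measure_ne_top _ _) (measure_mono hsub)) ?_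
    rw [← pastLaw_apply ((measurableSet_noBlockRenewal k).union hm)]
    exact measureReal_union_le _ _
  refine h1.trans (add_le_add le_rfl ((hgood.measureReal_le_totalLen hs hfin n k).trans ?_))
  rw [← hK, inv_pow, div_le_iff₀ (by positivity), inv_mul_eq_div, le_div_iff₀ (by positivity)]
  calc K ^ k * s ^ (n / 2) ≤ (s ^ q) ^ k * s ^ (n / 2) :=
        mul_le_mul_of_nonneg_right (pow_le_pow_left₀ hK0 hq.le k) (by positivity)
    _ = s ^ (q * k + n / 2) := by rw [← pow_mul, pow_add]
    _ ≤ s ^ n := pow_le_pow_right₀ hs.le (by omega)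

end CoalescenceTail

/-! ### The three regimes -/

section Regimes

/-- A divergent series of products stays divergent if all but finitely many factors are increased
and the other ones are replaced by arbitrary positive numbers. -/
lemma tendsto_sum_prod_of_le {a b : ℕ → ℝ} (hb : ∀ j, 0 < b j)
    (hab : ∀ᶠ j in atTop, 0 < a j ∧ a j ≤ b j) (hdiv : DivergentSumProd a) :
    Tendsto (fun n => ∑ k ∈ Finset.range n, ∏ j ∈ Finset.range k, b j) atTop atTop := by
  have hg : ∀ k, 0 < ∏ j ∈ Finset.range k, b j := fun k => Finset.prod_pos fun j _ => hb j
  obtain ⟨M, hM⟩ := eventually_atTop.1 hab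
  obtain ⟨C, hC, hle⟩ : ∃ C > 0, ∀ k,
      |∏ j ∈ Finset.range k, a j| ≤ C * ∏ j ∈ Finset.range k, b j := by
    set c : ℕ → ℝ := fun k => |∏ j ∈ Finset.range k, a j| / ∏ j ∈ Finset.range k, b j with hc
    have hc0 : ∀ k, 0 ≤ c k := fun k => div_nonneg (abs_nonneg _) (hg k).le
    refine ⟨∑ k ∈ Finset.range (M + 1), c k + 1,
      add_pos_of_nonneg_of_pos (Finset.sum_nonneg fun k _ => hc0 k) one_pos, fun k => ?_⟩
    rcases le_total k M with hk | hk
    · rw [← div_le_iff₀ (hg k)]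
      have := Finset.single_le_sum (fun k _ => hc0 k) (Finset.mem_range.2 (Nat.lt_succ_of_le hk))
      linarith
    · induction k, hk using Nat.le_induction with
      | base =>
        rw [← div_le_iff₀ (hg M)]
        have := Finset.single_le_sum (fun k _ => hc0 k) (Finset.self_mem_range_succ M)
        linarith
      | succ k hk ih =>
        rw [Finset.prod_range_succ, Finset.prod_range_succ, abs_mul, abs_of_pos (hM k hk).1,
          ← mul_assoc]
        exact mul_le_mul ih (hM k hk).2 (hM k hk).1.le
          ((abs_nonneg _).trans ih)
  have h1 : Tendsto (fun n => C * ∑ k ∈ Finset.range (n + 1), ∏ j ∈ Finset.range k, b j)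
      atTop atTop := by
    refine tendsto_atTop_mono (fun n => ?_) hdiv
    rw [Finset.mul_sum]
    calc ∑ k ∈ Finset.Icc 1 n, ∏ j ∈ Finset.range k, a j
        ≤ ∑ k ∈ Finset.Icc 1 n, C * ∏ j ∈ Finset.range k, b j :=
          Finset.sum_le_sum fun k _ => (le_abs_self _).trans (hle k)
      _ ≤ _ := Finset.sum_le_sum_of_subset_of_nonneg
          (fun k hk => Finset.mem_range.2 (Nat.lt_succ_of_le (Finset.mem_Icc.1 hk).2))
          fun k _ _ => mul_nonneg hC.le (hg k).le
  exact (tendsto_add_atTop_iff_nat 1).1 ((tendsto_const_mul_atTop_of_pos hC).1 h1)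

variable {A : Type*} [Fintype A] [LinearOrder A] {P : TransitionKernel A} {τ : ContextTree A}
  {h : List A → ℕ}

lemma WeaklyNonNull.nonempty {A : Type*} [Fintype A] {P : TransitionKernel A}
    (hα : WeaklyNonNull P) : Nonempty A := by
  by_contra hA
  rw [not_nonempty_iff] at hA
  simp [WeaklyNonNull, alphaMinusOne] at hα

lemma WeaklyNonNull.reachLE_pos (hα : WeaklyNonNull P) (m : ℕ) :
    0 < pastLaw.real (reachLE P τ h m) :=
  have := hα.nonempty
  hα.trans_le (alphaMinusOne_le_reachLE m)

lemma IsGood.tendsto_blockTail (hgood : IsGood P τ) (hτ : τ.IsSkeleton) (hα : WeaklyNonNull P)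
    (hdiv : DivergentSumProd (slcSeq P τ h)) : Tendsto (blockTail P τ h) atTop (𝓝 0) := by
  refine tendsto_renewal_tail (fun n => measureReal_nonneg) blockTail_antitone
    (fun n => (Finset.prod_pos fun j _ => hα.reachLE_pos j).le) hgood.sum_blockTail ?_
  -- Without stars `A_m` need not tend to `1`, but then no block involves its past.
  by_cases hstar : unifSeq {u | letterOf P (u 0) = none} = 0
  · have hone : ∀ m, pastLaw.real (reachLE P τ h m) = 1 := fun m => by
      have h1 := one_sub_measure_star_le_reachLE (P := P) (τ := τ) (h := h) m
      rw [hstar, tsub_zero] at h1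
      rw [Measure.real, le_antisymm prob_le_one h1, ENNReal.toReal_one]
    simpa [hone] using tendsto_natCast_atTop_atTop (R := ℝ)
  · refine tendsto_sum_prod_of_le hα.reachLE_pos ?_ hdiv
    filter_upwards [hgood.eventually_slcSeq_pos (h := h) hstar, eventually_ne_atTop 0,
      eventually_ge_atTop (h [])] with m h1 h2 h3
    exact ⟨h1, hgood.slcSeq_le_reachLE hτ h2 h3⟩

lemma IsGood.one_sub_reachLE_le (hgood : IsGood P τ) (hτ : τ.IsSkeleton) :
    ∀ m ≥ h [] + 1, 1 - pastLaw.real (reachLE P τ h m) ≤ 1 - slcSeq P τ h m :=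
  fun m hm => sub_le_sub_left (hgood.slcSeq_le_reachLE hτ (by omega) (by omega)) 1

lemma IsGood.summable_blockTail (hgood : IsGood P τ) (hτ : τ.IsSkeleton) (hα : WeaklyNonNull P)
    (hsum : Summable fun k => 1 - slcSeq P τ h k) : Summable (blockTail P τ h) := by
  have hb : Summable fun m => 1 - pastLaw.real (reachLE P τ h m) := by
    have h1 := (summable_nat_add_iff (h [] + 1)).2 hsum
    exact (summable_nat_add_iff (h [] + 1)).1 (Summable.of_nonneg_of_le
      (fun m => sub_nonneg.2 measureReal_le_one)
      (fun m => hgood.one_sub_reachLE_le hτ (m + (h [] + 1)) (by omega)) h1)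
  obtain ⟨γ, hγ, hle⟩ := exists_pos_le_prod hα.reachLE_pos (fun m => measureReal_le_one) hb
  exact summable_renewal_tail hγ (fun n => measureReal_nonneg) hle hgood.sum_blockTail

lemma IsGood.expDecay_blockTail (hgood : IsGood P τ) (hτ : τ.IsSkeleton) (hα : WeaklyNonNull P)
    (hexp : ExpDecay fun k => 1 - slcSeq P τ h k) : ExpDecay (blockTail P τ h) := by
  refine expDecay_renewal_tail (by simp [blockTail, noBlockRenewal, noRenewal_zero])
    hα.reachLE_pos (fun m => measureReal_le_one) ?_ hgood.sum_blockTail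
  exact hexp.of_le_of_ge (h [] + 1) (fun m => sub_le_self _ measureReal_nonneg)
    (hgood.one_sub_reachLE_le hτ)

lemma ExpDecay.tendsto_zero {c : ℕ → ℝ} (hc : ExpDecay c) (h0 : ∀ n, 0 ≤ c n) :
    Tendsto c atTop (𝓝 0) := by
  obtain ⟨D, d, -, hd0, hd1, hcd⟩ := hc
  have := (tendsto_pow_atTop_nhds_zero_of_lt_one hd0.le hd1).const_mul D
  rw [mul_zero] at this
  exact squeeze_zero h0 hcd this

end Regimes

end ContextChain


theorem corollary4 {A : Type*} [Fintype A] [LinearOrder A]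
    (P : TransitionKernel A) (τ : ContextTree A) (h : List A → ℕ)
    (hτ : τ.IsSkeleton)
    (hP : IsSLCWith P τ h)
    (hα : WeaklyNonNull P)
    (hgood : IsGood P τ) :
    ∃ F : (ℕ → A) → UnitIco → A, IsUpdate P F ∧
      (DivergentSumProd (slcSeq P τ h) →
        (∀ᵐ u ∂unifSeq, absCoal F u < ⊤) ∧ IsFeasible F) ∧
      (Summable (fun k => 1 - slcSeq P τ h k) →
        SummableTail (absCoal F) ∧ IsFeasible F) ∧
      (ExpTail (absGood P τ) ∧ ExpDecay (fun k => 1 - slcSeq P τ h k) →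
        ExpTail (absCoal F) ∧ IsFeasible F) := by
  refine ⟨update P, isUpdate_update P, fun hdiv => ?_, fun hsum => ?_, fun ⟨hbar, hexp⟩ => ?_⟩
  · have hae := ae_absCoal_lt_top hP (hgood.tendsto_blockTail hτ hα hdiv)
    exact ⟨hae, isFeasible_of_ae hae⟩
  · have hr := hgood.summable_blockTail hτ hα hsum
    exact ⟨hgood.summableTail hP hr,
      isFeasible_of_ae (ae_absCoal_lt_top hP hr.tendsto_atTop_zero)⟩
  · have hr := hgood.expDecay_blockTail hτ hα hexp
    exact ⟨hgood.expTail hP hbar hr,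
      isFeasible_of_ae (ae_absCoal_lt_top hP (hr.tendsto_zero fun n => measureReal_nonneg))⟩
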